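/- \textbf{Conventions.} The language of groups has a binary operation, a unary inverse and a constant for the identity. Finitary quantifier-free formulas (negations only on atomic formulas) are computable $\Sigma_0$ and computable $\Pi_0$. For $\alpha>0$, a computable $\Sigma_\alpha$ formula $\varphi(\bar x)$ is a c.e. disjunction of formulas $(\exists\bar y)\,\psi(\bar x,\bar y)$ with $\psi$ computable $\Pi_\beta$ for some $\beta<\alpha$, and a computable $\Pi_\alpha$ formula is a c.e. conjunction of formulas $(\forall\bar y)\,\psi(\bar x,\bar y)$ with $\psi$ computable $\Sigma_\beta$ for some $\beta<\alpha$ (c.e. sets being sets of indices of formulas). A \emph{computable $d$-$\Sigma_2$ Scott sentence} for a countable structure $\mathcal A$ is the conjunction of a computable $\Sigma_2$ sentence and a computable $\Pi_2$ sentence whose countable models are exactly the isomorphic copies of $\mathcal A$. A structure with universe a subset of $\mathbb N$ is \emph{computable} if its atomic diagram $D(\mathcal B)$ (the set of Gödel numbers of the true atomic and negated atomic sentences with constants for the elements of $\mathcal B$) is computable; a group is called computable if it is isomorphic to such a structure. The \emph{index set} $I(\mathcal A)$ is the set of all $e\in\mathbb N$ such that $\varphi_e$, the $e$-th partial computable function,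 is the characteristic function of $D(\mathcal B)$ for some $\mathcal B\cong\mathcal A$ with universe a subset of $\mathbb N$. A set $S\subseteq\mathbb N$ is $d$-$\Sigma^0_2$ if $S=S_1\setminus S_2$ with $S_1,S_2$ both $\Sigma^0_2$; it is \emph{$m$-complete $d$-$\Sigma^0_2$} if moreover every $d$-$\Sigma^0_2$ set is many-one reducible to it. \textbf{Theorem.} Let $G$ be a computable additive subgroup of $\mathbb Q$ and fix a nonzero element $u\in G$ (playing the role of $1$). Let \[P^0=\{p \text{ prime}: p\nmid u \text{ in } G\},\] \[P^{fin}=\{p\text{ prime}: \text{for some } k>0,\ p^k\mid u\text{ and }p^{k+1}\nmid u \text{ in } G\},\] \[P^\infty=\{p\text{ prime}: p^k\mid u\text{ in } G \text{ for all } k>0\},\] where $m\mid u$ in $G$ means that $my=u$ for some $y\in G$. Suppose that $P^0$ is infinite, $P^{fin}$ is finite and $P^\infty$ is finite. Then $G$ has a computable $d$-$\Sigma_2$ Scott sentence, and $I(G)$ is $m$-complete $d$-$\Sigma^0_2$. -/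

import Mathlib

open scoped FirstOrder

namespace ScottSentence

/-! ### The language of groups (written additively) -/

/-- The function symbols of the language of groups. -/
inductive GroupFunc : ℕ → Type
  | zero : GroupFunc 0
  | neg : GroupFunc 1
  | add : GroupFunc 2

/-- The language of groups: a binary operation, a unary inverse and a constant for the identity. -/
def groupLang : FirstOrder.Language.{0, 0} := ⟨GroupFunc, fun _ => Empty⟩

/-- Every additive group is a structure for the language of groups. An arbitrary structure for
this language need not satisfy the group axioms. -/
instance instStructureOfAddGroup (A : Type*) [AddGroup A] : groupLang.Structure A where
  funMap := fun f => match f with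
    | GroupFunc.zero => fun _ => 0
    | GroupFunc.neg => fun x => -x 0
    | GroupFunc.add => fun x => x 0 + x 1
  RelMap := fun r => nomatch r

/-! ### Goedel numbering -/

/-- The Goedel number of a term whose variables (or constants) are numbered by `v`. -/
def termCode {α : Type*} (v : α → ℕ) : groupLang.Term α → ℕ
  | .var a => 3 * v a + 1
  | .func GroupFunc.zero _ => 0
  | .func GroupFunc.neg ts => 3 * termCode v (ts 0) + 2
  | .func GroupFunc.add ts => 3 * Nat.pair (termCode v (ts 0)) (termCode v (ts 1)) + 3

theorem termCode_injective {α : Type*} {v : α → ℕ} (hv : Function.Injective v) :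
    Function.Injective (termCode v) := by
  intro s
  induction s with
  | var a =>
    intro t h
    match t with
    | .var b =>
      simp only [termCode] at h
      rw [hv (by omega : v a = v b)]
    | .func GroupFunc.zero _ => simp only [termCode] at h; omega
    | .func GroupFunc.neg _ => simp only [termCode] at h; omega
    | .func GroupFunc.add _ => simp only [termCode] at h; omega
  | func f ss ih =>
    intro t h
    match f, ss, ih, t, h with
    | GroupFunc.zero, _, _, .var b, h => simp only [termCode] at h; omega
    | GroupFunc.zero, _, _, .func GroupFunc.neg _, h => simp only [termCode] at h; omega
    | GroupFunc.zero, _, _, .func GroupFunc.add _, h => simp only [termCode] at h; omega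
    | GroupFunc.zero, ss, _, .func GroupFunc.zero ts, _ =>
      exact congrArg _ (funext fun i => i.elim0)
    | GroupFunc.neg, _, _, .var b, h => simp only [termCode] at h; omega
    | GroupFunc.neg, _, _, .func GroupFunc.zero _, h => simp only [termCode] at h; omega
    | GroupFunc.neg, _, _, .func GroupFunc.add _, h => simp only [termCode] at h; omega
    | GroupFunc.neg, ss, ih, .func GroupFunc.neg ts, h =>
      simp only [termCode] at h
      have h0 := ih 0 (by omega : termCode v (ss 0) = termCode v (ts 0))
      refine congrArg _ (funext fun i => ?_)
      fin_cases i
      exact h0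
    | GroupFunc.add, _, _, .var b, h => simp only [termCode] at h; omega
    | GroupFunc.add, _, _, .func GroupFunc.zero _, h => simp only [termCode] at h; omega
    | GroupFunc.add, _, _, .func GroupFunc.neg _, h => simp only [termCode] at h; omega
    | GroupFunc.add, ss, ih, .func GroupFunc.add ts, h =>
      simp only [termCode] at h
      have hp := Nat.pair_eq_pair.1 (by omega :
        Nat.pair (termCode v (ss 0)) (termCode v (ss 1)) =
          Nat.pair (termCode v (ts 0)) (termCode v (ts 1)))
      have h0 := ih 0 hp.1
      have h1 := ih 1 hp.2
      refine congrArg _ (funext fun i => ?_)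
      fin_cases i
      · exact h0
      · exact h1

/-- Finitary quantifier-free formulas, in normal form, with free variables `x₀, …, xₙ₋₁`. -/
inductive QF (n : ℕ) : Type
  | eq (s t : groupLang.Term (Fin n)) : QF n
  | ne (s t : groupLang.Term (Fin n)) : QF n
  | and (φ ψ : QF n) : QF n
  | or (φ ψ : QF n) : QF n

/-- Truth of a quantifier-free formula at a tuple of a structure. -/
def QF.Realize {A : Type*} [groupLang.Structure A] {n : ℕ} (v : Fin n → A) : QF n → Prop
  | .eq s t => s.realize v = t.realize v
  | .ne s t => s.realize v ≠ t.realize v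
  | .and φ ψ => φ.Realize v ∧ ψ.Realize v
  | .or φ ψ => φ.Realize v ∨ ψ.Realize v

/-- The Goedel number of a quantifier-free formula. -/
def QF.code {n : ℕ} : QF n → ℕ
  | .eq s t => 4 * Nat.pair (termCode Fin.val s) (termCode Fin.val t)
  | .ne s t => 4 * Nat.pair (termCode Fin.val s) (termCode Fin.val t) + 1
  | .and φ ψ => 4 * Nat.pair φ.code ψ.code + 2
  | .or φ ψ => 4 * Nat.pair φ.code ψ.code + 3

theorem QF.code_injective {n : ℕ} : Function.Injective (QF.code (n := n)) := by
  intro φ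
  induction φ with
  | eq s t | ne s t =>
    intro ψ h
    cases ψ <;> simp only [QF.code] at h <;> try omega
    rename_i s' t'
    have hp := Nat.pair_eq_pair.1 (by omega :
      Nat.pair (termCode Fin.val s) (termCode Fin.val t) =
        Nat.pair (termCode Fin.val s') (termCode Fin.val t'))
    rw [termCode_injective Fin.val_injective hp.1, termCode_injective Fin.val_injective hp.2]
  | and a b iha ihb | or a b iha ihb =>
    intro ψ h
    cases ψ <;> simp only [QF.code] at h <;> try omega
    rename_i a' b'
    have hp := Nat.pair_eq_pair.1 (by omega :
      Nat.pair a.code b.code = Nat.pair a'.code b'.code)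
    rw [iha hp.1, ihb hp.2]

/-! ### Computable infinitary formulas -/

/-- The partial computable function `φ_e` with index `e`. -/
def phi (e : ℕ) : ℕ →. ℕ := (Denumerable.ofNat Nat.Partrec.Code e).eval

/-- The c.e. set `W_e`, the domain of `φ_e`. -/
def W (e : ℕ) : Set ℕ := {m | (phi e m).Dom}

/-- `IsIndex α n e`: the number `e` is an index of a computable `Σ_α` formula (and, read dually, of
a computable `Π_α` formula) with free variables `x₀, …, xₙ₋₁`.

For `α = 0`, `e` is the Goedel number of a finitary quantifier-free formula. For `α > 0`, every
element of the c.e. set `W_e` codes a triple `(β, k, j)`, where `β < α` and `j` is an index at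
level `β` of a formula `ψ` in the variables `x₀, …, xₙ₋₁, y₀, …, yₖ₋₁`; the triple stands for
the disjunct `(∃ y₀ … yₖ₋₁) ψ` with `ψ` computable `Π_β` (respectively, for the conjunct
`(∀ y₀ … yₖ₋₁) ψ` with `ψ` computable `Σ_β`). -/
def IsIndex (α n e : ℕ) : Prop :=
  match α with
  | 0 => ∃ φ : QF n, φ.code = e
  | α + 1 => ∀ m ∈ W e, ∃ (β : ℕ) (_ : β < α + 1) (k j : ℕ),
      m = Nat.pair β (Nat.pair k j) ∧ IsIndex β (n + k) j
termination_by α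

mutual

/-- Truth, at the tuple `v`, of the computable `Σ_α` formula with index `e`. -/
def SatSigma {A : Type*} [groupLang.Structure A] (α n e : ℕ) (v : Fin n → A) : Prop :=
  match α with
  | 0 => ∃ φ : QF n, φ.code = e ∧ φ.Realize v
  | α + 1 => ∃ (β : ℕ) (_ : β < α + 1) (k j : ℕ), Nat.pair β (Nat.pair k j) ∈ W e ∧
      ∃ y : Fin k → A, SatPi β (n + k) j (Fin.append v y)
termination_by α

/-- Truth, at the tuple `v`, of the computable `Π_α` formula with index `e`. -/
def SatPi {A : Type*} [groupLang.Structure A] (α n e : ℕ) (v : Fin n → A) : Prop :=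
  match α with
  | 0 => ∃ φ : QF n, φ.code = e ∧ φ.Realize v
  | α + 1 => ∀ (β : ℕ) (_ : β < α + 1) (k j : ℕ), Nat.pair β (Nat.pair k j) ∈ W e →
      ∀ y : Fin k → A, SatSigma β (n + k) j (Fin.append v y)
termination_by α

end

/-- `G` has a computable `d`-`Σ₂` Scott sentence: there are a computable `Σ₂` sentence `σ` and a
computable `Π₂` sentence `π` such that the countable models of `σ ∧ π` are exactly the isomorphic
copies of `G`. -/
def HasComputableDSigma2ScottSentence (G : Type*) [groupLang.Structure G] : Prop :=
  ∃ σ π : ℕ, IsIndex 2 0 σ ∧ IsIndex 2 0 π ∧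
    ∀ (A : Type) [groupLang.Structure A] [Countable A],
      (SatSigma 2 0 σ (Fin.elim0 : Fin 0 → A) ∧ SatPi 2 0 π (Fin.elim0 : Fin 0 → A)) ↔
        Nonempty (A ≃[groupLang] G)

/-! ### Atomic diagrams, computable structures, index sets -/

/-- The atomic diagram of a structure with universe `U ⊆ ℕ`: the set of Goedel numbers of the
atomic sentences `s = t`, and negated atomic sentences `s ≠ t`, that are true in the structure,
in the language of groups with a constant for each element of `U`. -/
def atomicDiagram (U : Set ℕ) [groupLang.Structure U] : Set ℕ :=
  {m | ∃ s t : groupLang.Term U,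
    (s.realize id = t.realize id ∧
      m = 2 * Nat.pair (termCode Subtype.val s) (termCode Subtype.val t)) ∨
    (s.realize id ≠ t.realize id ∧
      m = 2 * Nat.pair (termCode Subtype.val s) (termCode Subtype.val t) + 1)}

/-- `G` is isomorphic to a computable structure, that is, to a structure with universe a subset
of `ℕ` whose atomic diagram is computable. -/
def HasComputableCopy (G : Type*) [groupLang.Structure G] : Prop :=
  ∃ (U : Set ℕ) (_ : groupLang.Structure U),
    ComputablePred (fun m => m ∈ atomicDiagram U) ∧ Nonempty (U ≃[groupLang] G)

/-- The partial function `f` is (total and equal to) the characteristic function of `S`. -/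
def IsCharFun (f : ℕ →. ℕ) (S : Set ℕ) : Prop :=
  ∀ m, (m ∈ S → f m = Part.some 1) ∧ (m ∉ S → f m = Part.some 0)

/-- The index set `I(G)`: all `e` such that `φ_e` is the characteristic function of the atomic
diagram of an isomorphic copy of `G`. -/
def indexSet (G : Type*) [groupLang.Structure G] : Set ℕ :=
  {e | ∃ (U : Set ℕ) (_ : groupLang.Structure U),
    Nonempty (U ≃[groupLang] G) ∧ IsCharFun (phi e) (atomicDiagram U)}

/-! ### Arithmetical complexity -/

/-- `Σ⁰₂` sets of natural numbers. -/
def IsSigma02 (S : Set ℕ) : Prop :=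
  ∃ R : ℕ × ℕ × ℕ → Prop, ComputablePred R ∧ ∀ n, n ∈ S ↔ ∃ x, ∀ y, R (n, x, y)

/-- `d`-`Σ⁰₂` sets: differences of two `Σ⁰₂` sets. -/
def IsDSigma02 (S : Set ℕ) : Prop :=
  ∃ S₁ S₂ : Set ℕ, IsSigma02 S₁ ∧ IsSigma02 S₂ ∧ S = S₁ \ S₂

/-- `I` is `m`-complete `d`-`Σ⁰₂`. -/
def IsMCompleteDSigma02 (I : Set ℕ) : Prop :=
  IsDSigma02 I ∧ ∀ S : Set ℕ, IsDSigma02 S → (fun n => n ∈ S) ≤₀ (fun n => n ∈ I)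

/-! ### Divisibility by primes in a group, relative to a fixed element `u` (the role of `1`) -/

/-- `G ⊨ m ∣ u`. -/
def DividesIn {G : Type*} [AddCommGroup G] (m : ℕ) (u : G) : Prop := ∃ y : G, m • y = u

/-- The set `P⁰` of primes that do not divide `u` in `G`. -/
def P0 {G : Type*} [AddCommGroup G] (u : G) : Set ℕ :=
  {p | p.Prime ∧ ¬ DividesIn p u}

/-- The set `P^fin` of primes `p` such that, for some `k > 0`, `p ^ k` divides `u` in `G` and
`p ^ (k + 1)` does not. -/
def Pfin {G : Type*} [AddCommGroup G] (u : G) : Set ℕ :=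
  {p | p.Prime ∧ ∃ k > 0, DividesIn (p ^ k) u ∧ ¬ DividesIn (p ^ (k + 1)) u}

/-- The set `P^∞` of primes all of whose powers divide `u` in `G`. -/
def Pinf {G : Type*} [AddCommGroup G] (u : G) : Set ℕ :=
  {p | p.Prime ∧ ∀ k > 0, DividesIn (p ^ k) u}

end ScottSentence

namespace ScottSentence

/-! ### The groups `ℤ[1/N]` -/

-- Let `N` be the product of the primes in `Pinf u`. Since `Pfin u` is finite, the divisors of `u`
-- that are prime to `N` are bounded. Dividing `u` by the largest of them gives an element that
-- generates `G` over ℤ[1/N], so `G` is a copy of ℤ[1/N] (`exists_isIntAdjoinInv`). The axioms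
-- `IsIntAdjoinInv` determine this group: sending an indivisible `x` to 1 embeds any model in ℚ,
-- with image exactly the rationals having a power of `N` as denominator (`exists_hom`,
-- `nonempty_addEquiv`). The existence of an indivisible element is `Σ₂` and the other axioms are
-- `Π₂`, which gives the Scott sentence.
--
-- The upper bound for the index set comes from the same axioms, rewritten as conditions on a set
-- `D` of Goedel numbers. If `D` satisfies them, the closed terms modulo the equalities in `D` form
-- a copy of `G` with atomic diagram `D` (`exists_numbering_iff`). For `D` decided by `φ_e`, one
-- condition is `Σ⁰₂` and all others, totality included, are `Π⁰₂`.
--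
-- For hardness, let `S₁` and `S₂` be `Σ⁰₂`. A search for a witness of `n ∈ S₁` controls a group of
-- rationals with denominators `N ^ s * (N + 1) ^ x`, where `x` is the candidate current at step
-- `s`. If the candidates stabilise, the group is a copy of ℤ[1/N]; otherwise it is divisible by `N
-- + 1`, which is prime to `N`, and no element is indivisible. The diagram of this group is
-- primitive recursive uniformly in `n`. Its value at `m` is released only after the `m`-th
-- candidate witness of `n ∈ S₂` has been refuted, so the released function is total exactly when `n
-- ∉ S₂`.

/-- The axioms characterising the additive group `ℤ[1/N]` up to isomorphism: it is torsion-free,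
`N`-divisible, of rank at most one, and some nonzero element has no divisor `m > 1` prime to `N`. -/
structure IsIntAdjoinInv (N : ℕ) (A : Type*) [AddCommGroup A] : Prop where
  torsion_free : ∀ (m : ℕ) (x : A), (m + 1) • x = 0 → x = 0
  divisible : ∀ x : A, ∃ y, N • y = x
  rank_one : ∀ x y : A, ∃ m n : ℕ, (m + 1) • y = n • x ∨ (m + 1) • y = -(n • x) ∨ x = 0
  exists_indivisible : ∃ x : A, x ≠ 0 ∧
    ∀ (m a b : ℕ) (y : A), 1 < m → a * m = b * N + 1 → m • y ≠ x

theorem exists_dvd_pow_of_prime_dvd {N : ℕ} (d : ℕ) (hd : d ≠ 0)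
    (h : ∀ p, p.Prime → p ∣ d → p ∣ N) : ∃ k, d ∣ N ^ k := by
  induction d using Nat.strong_induction_on with
  | _ d ih =>
    by_cases h1 : d = 1
    · exact ⟨0, by simp [h1]⟩
    · have hp := Nat.minFac_prime h1
      obtain ⟨c, hc⟩ := Nat.minFac_dvd d
      have hc0 : c ≠ 0 := by rintro rfl; simp at hc; exact hd hc
      have hlt : c < d := by
        have := hp.two_le
        rw [hc]
        nlinarith [Nat.pos_of_ne_zero hc0]
      obtain ⟨k, hk⟩ := ih c hlt hc0 fun p pp pc => h p pp (hc ▸ Dvd.dvd.mul_left pc _)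
      refine ⟨k + 1, ?_⟩
      rw [hc, pow_succ, mul_comm]
      exact mul_dvd_mul hk (h _ hp (Nat.minFac_dvd d))

/-- Bezout with both coefficients natural. This lets the axioms say "prime to `N`" by an equation
between natural numbers. -/
theorem exists_mul_eq_of_coprime {m N : ℕ} (hm : 1 < m) (h : m.Coprime N) :
    ∃ a b : ℕ, a * m = b * N + 1 := by
  rcases Nat.lt_trichotomy N 1 with hN | rfl | hN
  · obtain rfl : N = 0 := by omega
    rw [Nat.coprime_zero_right] at h
    omega
  · exact ⟨1, m - 1, by omega⟩
  · obtain ⟨a, -, ha⟩ := Nat.exists_mul_mod_eq_one_of_coprime h hN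
    refine ⟨a, m * a / N, ?_⟩
    have := Nat.div_add_mod (m * a) N
    rw [mul_comm a m, mul_comm _ N]
    omega

namespace IsIntAdjoinInv

variable {N : ℕ} {A : Type*} [AddCommGroup A]

theorem zsmul_eq_zero (h : IsIntAdjoinInv N A) {b : ℤ} (hb : b ≠ 0) {x : A} (hx : b • x = 0) :
    x = 0 := by
  have h1 : b.natAbs • x = 0 := by
    rcases Int.natAbs_eq b with h2 | h2
    · rw [h2] at hx; simpa using hx
    · rw [h2] at hx; simpa using hx
  obtain ⟨k, hk⟩ := Nat.exists_eq_succ_of_ne_zero (Int.natAbs_ne_zero.2 hb)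
  exact h.torsion_free k x (by rw [← Nat.succ_eq_add_one, ← hk]; exact h1)

theorem cross_mul (h : IsIntAdjoinInv N A) {x y : A} {a b a' b' : ℤ} (hb : b ≠ 0)
    (hab : b • y = a • x) (heq : a * b' = a' * b) : b' • y = a' • x := by
  rw [← sub_eq_zero]
  refine h.zsmul_eq_zero hb ?_
  rw [smul_sub, smul_smul, mul_comm, ← smul_smul, hab, smul_smul, smul_smul, mul_comm b', heq,
    mul_comm, sub_self]

theorem exists_rat (h : IsIntAdjoinInv N A) {x : A} (hx : x ≠ 0) (y : A) :
    ∃ r : ℚ, (r.den : ℤ) • y = r.num • x := by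
  obtain ⟨m, n, hmn⟩ := h.rank_one x y
  obtain ⟨a, ha⟩ : ∃ a : ℤ, ((m + 1 : ℕ) : ℤ) • y = a • x := by
    rcases hmn with h1 | h1 | h1
    · exact ⟨n, by rw [natCast_zsmul, natCast_zsmul, h1]⟩
    · exact ⟨-n, by rw [natCast_zsmul, neg_smul, natCast_zsmul, h1]⟩
    · exact absurd h1 hx
  have hm0 : ((m + 1 : ℕ) : ℤ) ≠ 0 := by positivity
  refine ⟨a / ((m + 1 : ℕ) : ℤ), h.cross_mul hm0 ha ?_⟩
  have h2 := Rat.num_div_den ((a : ℚ) / ((m + 1 : ℕ) : ℤ))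
  set r := (a : ℚ) / ((m + 1 : ℕ) : ℤ)
  have hd : (r.den : ℚ) ≠ 0 := by exact_mod_cast r.den_nz
  have hm1 : (((m + 1 : ℕ) : ℤ) : ℚ) ≠ 0 := by exact_mod_cast hm0
  have : (r.num : ℚ) / r.den = a / ((m + 1 : ℕ) : ℤ) := h2
  rw [div_eq_div_iff hd hm1] at this
  exact_mod_cast this.symm

/-- An indivisible `x` serves as the unit: `y` goes to `a / b` when `b • y = a • x`. The description
of the range mentions neither `A` nor `x`, which is why any two models are isomorphic. -/
theorem exists_hom (h : IsIntAdjoinInv N A) : ∃ φ : A →+ ℚ, Function.Injective φ ∧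
    ∀ r : ℚ, r ∈ φ.range ↔ ∃ (k : ℕ) (a : ℤ), r * (N : ℚ) ^ k = a := by
  obtain ⟨x, hx, hxd⟩ := h.exists_indivisible
  choose f hf using h.exists_rat hx
  -- The rational `f y` is merely chosen; this shows that any relation `b • y = a • x` computes it,
  -- so additivity can be checked on convenient relations.
  have key : ∀ (y : A) (a b : ℤ), b ≠ 0 → b • y = a • x → f y = a / b := by
    intro y a b hb hab
    have h1 : ((f y).den * a) • x = (b * (f y).num) • x := by
      rw [← smul_smul, ← hab, ← smul_smul, ← hf y, smul_smul, smul_smul, mul_comm]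
    have h2 : ((f y).den * a : ℤ) = b * (f y).num := by
      by_contra hne
      refine hx (h.zsmul_eq_zero (sub_ne_zero.2 hne) ?_)
      rw [sub_smul, h1, sub_self]
    rw [← Rat.num_div_den (f y), div_eq_div_iff (by exact_mod_cast (f y).den_nz)
      (by exact_mod_cast hb)]
    have h3 : ((f y).den * a : ℚ) = b * (f y).num := by exact_mod_cast h2
    linarith
  have hden : ∀ y, ((f y).den : ℤ) ≠ 0 := fun y => by exact_mod_cast (f y).den_nz
  have hadd : ∀ y z, f (y + z) = f y + f z := by
    intro y z
    rw [key (y + z) ((f y).num * (f z).den + (f z).num * (f y).den) ((f y).den * (f z).den)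
      (mul_ne_zero (hden y) (hden z))]
    · conv_rhs => rw [← Rat.num_div_den (f y), ← Rat.num_div_den (f z)]
      have h1 : ((f y).den : ℚ) ≠ 0 := by exact_mod_cast hden y
      have h2 : ((f z).den : ℚ) ≠ 0 := by exact_mod_cast hden z
      push_cast
      field_simp
    · rw [smul_add, add_smul, mul_smul, mul_smul, mul_comm, mul_smul, smul_comm, hf y, hf z,
        mul_comm (f z).num, mul_smul]
  refine ⟨AddMonoidHom.mk' f hadd, ?_, ?_⟩
  · rw [injective_iff_map_eq_zero]
    intro y hy
    have hy' : f y = 0 := hy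
    have := hf y
    rw [hy'] at this
    simpa using this
  · intro r
    constructor
    · rintro ⟨y, rfl⟩
      change ∃ (k : ℕ) (a : ℤ), f y * (N : ℚ) ^ k = a
      obtain ⟨k, c, hc⟩ := exists_dvd_pow_of_prime_dvd (N := N) (f y).den (f y).den_nz (by
        intro p hp hpd
        by_contra hpN
        obtain ⟨a, b, hab⟩ := exists_mul_eq_of_coprime hp.one_lt ((Nat.Prime.coprime_iff_not_dvd hp).2 hpN)
        obtain ⟨d, hd⟩ := hpd
        have hcop : IsCoprime ((p : ℤ)) (f y).num := by
          have := (f y).reduced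
          rw [hd] at this
          rw [Int.isCoprime_iff_gcd_eq_one, Int.gcd_comm]
          exact Nat.Coprime.coprime_mul_right_right this
        obtain ⟨s, t, hst⟩ := hcop
        -- With `s * p + t * num = 1` and `den = p * d`, multiplying this element by `p` gives `(s *
        -- p + t * num) • x = x`, against the indivisibility of `x`.
        refine hxd p a b (s • x + (t * d) • y) hp.one_lt hab ?_
        rw [← natCast_zsmul, smul_add, smul_smul, smul_smul]
        have h1 : ((p : ℤ) * (t * d)) • y = (t * (f y).num) • x := by
          rw [mul_smul t, ← hf y, hd, smul_smul]
          congr 1; push_cast; ring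
        rw [h1, ← add_smul, mul_comm (p : ℤ), hst, one_smul])
      refine ⟨k, (f y).num * c, ?_⟩
      have h1 : ((f y).den : ℚ) ≠ 0 := by exact_mod_cast hden y
      have h2 : (N : ℚ) ^ k = (f y).den * c := by exact_mod_cast hc
      rw [h2, ← mul_assoc, Rat.mul_den_eq_num]
      push_cast; rfl
    · rintro ⟨k, a, hr⟩
      have hdiv : ∀ k : ℕ, ∃ y : A, N ^ k • y = x := by
        intro k
        induction k with
        | zero => exact ⟨x, by simp⟩
        | succ k ih =>
          obtain ⟨y, hy⟩ := ih
          obtain ⟨z, hz⟩ := h.divisible y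
          exact ⟨z, by rw [pow_succ, mul_smul, hz, hy]⟩
      obtain ⟨y, hy⟩ := hdiv k
      have hN : N ≠ 0 := by
        rintro rfl
        obtain ⟨z, hz⟩ := h.divisible x
        exact hx (by rw [← hz, zero_smul])
      have hN' : ((N ^ k : ℕ) : ℤ) ≠ 0 := by exact_mod_cast pow_ne_zero k hN
      refine ⟨a • y, ?_⟩
      change f (a • y) = r
      rw [key (a • y) a (N ^ k : ℕ) hN' (by rw [smul_comm, natCast_zsmul, hy]), ← hr]
      push_cast
      have : (N : ℚ) ^ k ≠ 0 := by exact_mod_cast pow_ne_zero k hN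
      field_simp

/-- The axioms determine the group up to isomorphism. -/
theorem nonempty_addEquiv (hA : IsIntAdjoinInv N A) {B : Type*} [AddCommGroup B]
    (hB : IsIntAdjoinInv N B) : Nonempty (A ≃+ B) := by
  obtain ⟨φ, hφ, hφr⟩ := hA.exists_hom
  obtain ⟨ψ, hψ, hψr⟩ := hB.exists_hom
  have : φ.range = ψ.range := by
    ext r
    rw [hφr, hψr]
  exact ⟨(AddMonoidHom.ofInjective hφ).trans ((AddEquiv.addSubgroupCongr this).trans
    (AddMonoidHom.ofInjective hψ).symm)⟩

theorem of_addEquiv {B : Type*} [AddCommGroup B] (e : A ≃+ B) (h : IsIntAdjoinInv N B) :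
    IsIntAdjoinInv N A where
  torsion_free m x hx := by
    have := h.torsion_free m (e x) (by rw [← map_nsmul, hx, map_zero])
    exact (map_eq_zero_iff e e.injective).1 this
  divisible x := by
    obtain ⟨y, hy⟩ := h.divisible (e x)
    exact ⟨e.symm y, by rw [← map_nsmul, hy, e.symm_apply_apply]⟩
  rank_one x y := by
    obtain ⟨m, n, hmn⟩ := h.rank_one (e x) (e y)
    refine ⟨m, n, ?_⟩
    rw [← map_nsmul, ← map_nsmul, ← map_neg, e.injective.eq_iff, e.injective.eq_iff,
      map_eq_zero_iff e e.injective] at hmn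
    exact hmn
  exists_indivisible := by
    obtain ⟨x, hx, hxd⟩ := h.exists_indivisible
    refine ⟨e.symm x, fun h0 => hx ((map_eq_zero_iff e.symm e.symm.injective).1 h0), ?_⟩
    intro m a b y hm hab hy
    exact hxd m a b (e y) hm hab (by rw [← map_nsmul, hy, e.apply_symm_apply])

end IsIntAdjoinInv

/-! ### Rank-one groups with finitely many relevant primes -/

section Subgroup

variable {G : AddSubgroup ℚ}

theorem exists_commensurable (x y : G) (hx : x ≠ 0) :
    ∃ (m : ℕ) (a : ℤ), ((m + 1 : ℕ) : ℤ) • y = a • x := by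
  have hx' : (x : ℚ) ≠ 0 := fun h => hx (Subtype.ext h)
  set r : ℚ := y / x with hr
  obtain ⟨m, hm⟩ := Nat.exists_eq_succ_of_ne_zero r.den_nz
  refine ⟨m, r.num, Subtype.ext ?_⟩
  have h1 : (y : ℚ) = r * x := by rw [hr]; field_simp
  have h2 := Rat.mul_den_eq_num r
  rw [hm] at h2
  push_cast at h2 ⊢
  simp only [zsmul_eq_mul]
  push_cast
  rw [h1, ← h2]
  ring

/-- Write `m + 1 = p ^ j * b` with `p` not dividing `b`, and `u = p ^ (j + 1) • v`. Cancelling `p ^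
j` in `(m + 1) • y = a • u` shows that `p` divides `b • y`; as `b` is prime to `p`, Bezout gives
that `p` divides `y`. -/
theorem divisible_of_mem_Pinf {u : G} (hu : u ≠ 0) {p : ℕ} (hp : p ∈ Pinf u) (y : G) :
    ∃ z, p • z = y := by
  obtain ⟨pp, hpk⟩ := hp
  obtain ⟨m, a, hma⟩ := exists_commensurable u y hu
  obtain ⟨j, b, hpb, hb⟩ := Nat.exists_eq_pow_mul_and_not_dvd (Nat.succ_ne_zero m) p pp.ne_one
  obtain ⟨v, hv⟩ := hpk (j + 1) j.succ_pos
  have h1 : b • y = p • (a • v) := by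
    apply Subtype.ext
    have h3 := congrArg (Subtype.val) hma
    have h4 := congrArg (Subtype.val) hv
    rw [← Nat.succ_eq_add_one, hb] at h3
    simp only [AddSubgroup.coe_zsmul, AddSubgroup.coe_nsmul, zsmul_eq_mul, nsmul_eq_mul] at h3 h4 ⊢
    push_cast at h3 h4
    have hp0 : (p : ℚ) ^ j ≠ 0 := pow_ne_zero _ (by exact_mod_cast pp.ne_zero)
    apply mul_left_cancel₀ hp0
    rw [← mul_assoc, h3, ← h4]
    ring
  have hcop : IsCoprime (p : ℤ) (b : ℤ) :=
    Nat.isCoprime_iff_coprime.2 ((Nat.Prime.coprime_iff_not_dvd pp).2 hpb)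
  obtain ⟨s, t, hst⟩ := hcop
  refine ⟨s • y + t • (a • v), ?_⟩
  have : y = (s * p + t * b) • y := by rw [hst, one_smul]
  conv_rhs => rw [this]
  rw [smul_add, add_smul, mul_smul, mul_smul, natCast_zsmul, natCast_zsmul, h1, smul_comm p s,
    smul_comm p t]

theorem mem_P0_or_Pfin_or_Pinf {p : ℕ} (pp : p.Prime) (u : G) :
    p ∈ P0 u ∨ p ∈ Pfin u ∨ p ∈ Pinf u := by
  classical
  by_cases h : ∀ k > 0, DividesIn (p ^ k) u
  · exact .inr (.inr ⟨pp, h⟩)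
  · push Not at h
    obtain ⟨hk0, hk⟩ := Nat.find_spec h
    set k := Nat.find h with hkdef
    by_cases h1 : k = 1
    · left; rw [h1, pow_one] at hk; exact ⟨pp, hk⟩
    · right; left
      refine ⟨pp, k - 1, by omega, ?_, by rwa [Nat.sub_add_cancel hk0]⟩
      by_contra hc
      have := Nat.find_min' h ⟨(by omega : k - 1 > 0), hc⟩
      omega

theorem DividesIn.of_dvd {A : Type*} [AddCommGroup A] {u : A} {m n : ℕ} (hmn : m ∣ n)
    (h : DividesIn n u) : DividesIn m u := by
  obtain ⟨c, rfl⟩ := hmn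
  obtain ⟨y, hy⟩ := h
  exact ⟨c • y, by rw [smul_smul, hy]⟩

/-- If `p ^ j` divides such an `m` and `j > 0`, then `p` divides `u` and does not divide `N`, so `p`
is in `Pfin u` and `j` is at most the exponent `k p`. Hence `m` divides a fixed finite product. -/
theorem exists_bound_of_Pfin_finite (u : G) (hfin : (Pfin u).Finite) {N : ℕ}
    (hN : ∀ p ∈ Pinf u, p ∣ N) :
    ∃ K, ∀ m : ℕ, m.Coprime N → DividesIn m u → m ≤ K := by
  have hk : ∀ p, ∃ k, p ∈ Pfin u → ¬ DividesIn (p ^ (k + 1)) u := by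
    intro p
    by_cases hp : p ∈ Pfin u
    · obtain ⟨_, k, _, _, h⟩ := hp
      exact ⟨k, fun _ => h⟩
    · exact ⟨0, fun h => absurd h hp⟩
  choose k hk using hk
  refine ⟨∏ p ∈ hfin.toFinset, p ^ k p, fun m hm hmu => Nat.le_of_dvd ?_ ?_⟩
  · refine Finset.prod_pos fun p hp => pow_pos ?_ _
    exact ((Set.Finite.mem_toFinset hfin).1 hp).1.pos
  · rw [Nat.dvd_iff_prime_pow_dvd_dvd]
    intro p j pp hj
    rcases Nat.eq_zero_or_pos j with rfl | hj0
    · simp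
    have hju : DividesIn (p ^ j) u := hmu.of_dvd hj
    have hpm : p ∣ m := (dvd_pow_self p hj0.ne').trans hj
    rcases mem_P0_or_Pfin_or_Pinf pp u with h | h | h
    · exact absurd (hju.of_dvd (dvd_pow_self p hj0.ne')) h.2
    · have hjk : j ≤ k p := by
        by_contra hc
        exact hk p h (hju.of_dvd (pow_dvd_pow p (by omega)))
      exact (pow_dvd_pow p hjk).trans
        (Finset.dvd_prod_of_mem (fun p => p ^ k p) ((Set.Finite.mem_toFinset hfin).2 h))
    · exact absurd (hN p h) ((Nat.Prime.coprime_iff_not_dvd pp).1 (hm.coprime_dvd_left hpm))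

theorem exists_isIntAdjoinInv (u : G) (hu : u ≠ 0) (hfin : (Pfin u).Finite)
    (hinf : (Pinf u).Finite) : ∃ N : ℕ, 0 < N ∧ IsIntAdjoinInv N G := by
  classical
  set N := ∏ p ∈ hinf.toFinset, p with hNdef
  have hN : ∀ p ∈ Pinf u, p ∣ N := fun p hp =>
    Finset.dvd_prod_of_mem (fun p => p) ((Set.Finite.mem_toFinset hinf).2 hp)
  refine ⟨N, Finset.prod_pos fun p hp => ((Set.Finite.mem_toFinset hinf).1 hp).1.pos,
    ⟨?_, ?_, ?_, ?_⟩⟩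
  · intro m x hx
    have h := congrArg Subtype.val hx
    simp only [AddSubgroup.coe_nsmul, nsmul_eq_mul, AddSubgroup.coe_zero, mul_eq_zero] at h
    rcases h with h | h
    · exact absurd h (by positivity)
    · exact Subtype.ext h
  · refine Finset.prod_induction (fun p => p) (fun n => ∀ x : G, ∃ y, n • y = x) ?_ ?_ ?_
    · intro a b ha hb x
      obtain ⟨y, hy⟩ := ha x
      obtain ⟨z, hz⟩ := hb y
      exact ⟨z, by rw [mul_smul, hz, hy]⟩
    · exact fun x => ⟨x, one_smul _ x⟩
    · exact fun p hp => divisible_of_mem_Pinf hu ((Set.Finite.mem_toFinset hinf).1 hp)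
  · intro x y
    by_cases hx : x = 0
    · exact ⟨0, 0, .inr (.inr hx)⟩
    obtain ⟨m, a, hma⟩ := exists_commensurable x y hx
    rw [natCast_zsmul] at hma
    refine ⟨m, a.natAbs, ?_⟩
    rcases Int.natAbs_eq a with h | h
    · left; rw [hma, ← natCast_zsmul, ← h]
    · right; left; rw [hma, ← natCast_zsmul, ← neg_smul, ← h]
  · obtain ⟨K, hK⟩ := exists_bound_of_Pfin_finite u hfin hN
    set S : ℕ → Prop := fun m => m.Coprime N ∧ DividesIn m u
    have h1 : S 1 := ⟨Nat.coprime_one_left N, u, one_smul _ u⟩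
    have hK1 : 1 ≤ K := hK 1 h1.1 h1.2
    obtain ⟨hmc, g, hg⟩ : S (Nat.findGreatest S K) := Nat.findGreatest_spec hK1 h1
    refine ⟨g, fun h0 => hu (by rw [← hg, h0, smul_zero]), ?_⟩
    intro m a b y hm hab hy
    have hcop : m.Coprime N := by
      rw [← Nat.isCoprime_iff_coprime]
      refine ⟨a, -b, ?_⟩
      have : (a * m : ℤ) = b * N + 1 := by exact_mod_cast hab
      linarith
    -- A further divisor `m > 1` of `g` prime to `N` would produce a larger divisor of `u` prime to
    -- `N`.
    have hS : S (Nat.findGreatest S K * m) :=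
      ⟨Nat.Coprime.mul_left hmc hcop, y, by rw [mul_smul, hy, hg]⟩
    have hle := Nat.le_findGreatest (hK _ hS.1 hS.2) hS
    have hpos : 1 ≤ Nat.findGreatest S K := Nat.le_findGreatest hK1 h1
    nlinarith

end Subgroup

/-! ### Evaluating term codes -/

section EvalCode

variable {B C : Type*} [Zero B] [Neg B] [Add B] [Zero C] [Neg C] [Add C]

/-- The value of the closed term with Goedel number `m`, where `ι a` is the value of the constant
numbered `a`, if there is one. -/
def evalCode (ι : ℕ → Option B) : ℕ → Option B
  | 0 => some 0
  | m + 1 =>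
    if m % 3 = 0 then ι (m / 3)
    else if m % 3 = 1 then (evalCode ι (m / 3)).map (- ·)
    else (evalCode ι (m / 3).unpair.1).bind fun x =>
      (evalCode ι (m / 3).unpair.2).map fun y => x + y
  termination_by m => m
  decreasing_by
  · exact Nat.lt_succ_of_le (Nat.div_le_self _ _)
  · exact Nat.lt_succ_of_le ((Nat.unpair_left_le _).trans (Nat.div_le_self _ _))
  · exact Nat.lt_succ_of_le ((Nat.unpair_right_le _).trans (Nat.div_le_self _ _))

variable (ι : ℕ → Option B)

theorem evalCode_zero : evalCode ι 0 = some 0 := by rw [evalCode]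

theorem evalCode_const (a : ℕ) : evalCode ι (3 * a + 1) = ι a := by
  rw [evalCode, if_pos (by omega), show 3 * a / 3 = a by omega]

theorem evalCode_neg (t : ℕ) : evalCode ι (3 * t + 2) = (evalCode ι t).map (- ·) := by
  rw [evalCode, if_neg (by omega), if_pos (by omega), show (3 * t + 1) / 3 = t by omega]

theorem evalCode_add (s t : ℕ) : evalCode ι (3 * Nat.pair s t + 3) =
    (evalCode ι s).bind fun x => (evalCode ι t).map fun y => x + y := by
  rw [evalCode, if_neg (by omega), if_neg (by omega),
    show (3 * Nat.pair s t + 2) / 3 = Nat.pair s t by omega, Nat.unpair_pair]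

theorem termCode_cases (m : ℕ) : m = 0 ∨ (∃ a, m = 3 * a + 1) ∨ (∃ t < m, m = 3 * t + 2) ∨
    ∃ s < m, ∃ t < m, m = 3 * Nat.pair s t + 3 := by
  rcases m with _ | m
  · exact .inl rfl
  have h3 := Nat.mod_lt m (show 0 < 3 by omega)
  have hl := Nat.unpair_left_le (m / 3)
  have hr := Nat.unpair_right_le (m / 3)
  rcases (by omega : m % 3 = 0 ∨ m % 3 = 1 ∨ m % 3 = 2) with h | h | h
  · exact .inr (.inl ⟨m / 3, by omega⟩)
  · exact .inr (.inr (.inl ⟨m / 3, by omega, by omega⟩))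
  · refine .inr (.inr (.inr ⟨(m / 3).unpair.1, by omega, (m / 3).unpair.2, by omega, ?_⟩))
    rw [Nat.pair_unpair]
    omega

/-- No group laws are needed. This matters for `Frac.toRat`, whose domain of unreduced fractions is
not a group. -/
theorem evalCode_map (f : B → C) (h0 : f 0 = 0) (hn : ∀ x, f (-x) = -f x)
    (ha : ∀ x y, f (x + y) = f x + f y) (m : ℕ) :
    evalCode (fun a => (ι a).map f) m = (evalCode ι m).map f := by
  induction m using Nat.strong_induction_on with
  | _ m ih =>
    rcases termCode_cases m with rfl | ⟨a, rfl⟩ | ⟨t, ht, rfl⟩ | ⟨s, hs, t, ht, rfl⟩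
    · simp [evalCode_zero, h0]
    · simp only [evalCode_const]
    · rw [evalCode_neg, evalCode_neg, ih t ht]
      cases evalCode ι t <;> simp [hn]
    · rw [evalCode_add, evalCode_add, ih s hs, ih t ht]
      cases evalCode ι s <;> cases evalCode ι t <;> simp [ha]

/-- The Goedel numbers of the true atomic and negated atomic sentences about the values of
constants given by `ι`. -/
def codeDiagram : Set ℕ :=
  {m | ∃ x y, evalCode ι (m / 2).unpair.1 = some x ∧ evalCode ι (m / 2).unpair.2 = some y ∧
    (m % 2 = 0 ↔ x = y)}

theorem even_mem_codeDiagram (s t : ℕ) : 2 * Nat.pair s t ∈ codeDiagram ι ↔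
    ∃ x, evalCode ι s = some x ∧ evalCode ι t = some x := by
  simp only [codeDiagram, Set.mem_ofPred_eq, show 2 * Nat.pair s t / 2 = Nat.pair s t by omega,
    Nat.unpair_pair, Nat.mul_mod_right, true_iff]
  constructor
  · rintro ⟨x, y, hx, hy, rfl⟩
    exact ⟨x, hx, hy⟩
  · rintro ⟨x, hx, hy⟩
    exact ⟨x, x, hx, hy, rfl⟩

theorem odd_mem_codeDiagram (s t : ℕ) : 2 * Nat.pair s t + 1 ∈ codeDiagram ι ↔
    ∃ x y, evalCode ι s = some x ∧ evalCode ι t = some y ∧ x ≠ y := by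
  simp only [codeDiagram, Set.mem_ofPred_eq, show (2 * Nat.pair s t + 1) / 2 = Nat.pair s t by omega,
    Nat.unpair_pair, show (2 * Nat.pair s t + 1) % 2 = 1 by omega, one_ne_zero, false_iff, ne_eq]

/-- Every element has exactly one number. -/
structure IsNumbering (ι : ℕ → Option B) : Prop where
  injective : ∀ a b x, ι a = some x → ι b = some x → a = b
  surjective : ∀ x, ∃ a, ι a = some x

end EvalCode

-- Atomic diagrams of copies of a group as diagrams of its numberings

section Structures

variable {B : Type*} [AddGroup B]

open FirstOrder Language

theorem equiv_realize {U : Set ℕ} [groupLang.Structure U] (e : U ≃[groupLang] B)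
    (τ : groupLang.Term U) : e (τ.realize id) = τ.realize fun a => e a := by
  rw [← HomClass.realize_term]
  rfl

theorem realize_zero {α : Type*} (v : α → B) (ts : Fin 0 → groupLang.Term α) :
    (Term.func (L := groupLang) GroupFunc.zero ts).realize v = 0 := rfl

theorem realize_neg {α : Type*} (v : α → B) (ts : Fin 1 → groupLang.Term α) :
    (Term.func (L := groupLang) GroupFunc.neg ts).realize v = -(ts 0).realize v := rfl

theorem realize_add {α : Type*} (v : α → B) (ts : Fin 2 → groupLang.Term α) :
    (Term.func (L := groupLang) GroupFunc.add ts).realize v =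
      (ts 0).realize v + (ts 1).realize v := rfl

theorem evalCode_termCode {U : Set ℕ} {ι : ℕ → Option B} {v : U → B}
    (hv : ∀ a : U, ι a = some (v a)) (τ : groupLang.Term U) :
    evalCode ι (termCode Subtype.val τ) = some (τ.realize v) := by
  induction τ with
  | var a => rw [termCode, evalCode_const, hv]; rfl
  | func f ts ih =>
    match f, ts, ih with
    | GroupFunc.zero, ts, _ => rw [termCode, evalCode_zero, realize_zero]
    | GroupFunc.neg, ts, ih => rw [termCode, evalCode_neg, ih 0, realize_neg]; rfl
    | GroupFunc.add, ts, ih => rw [termCode, evalCode_add, ih 0, ih 1, realize_add]; rfl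

theorem exists_term_of_evalCode {U : Set ℕ} {ι : ℕ → Option B} (hU : ∀ a, (ι a).isSome → a ∈ U)
    (m : ℕ) (h : (evalCode ι m).isSome) :
    ∃ τ : groupLang.Term U, termCode Subtype.val τ = m := by
  induction m using Nat.strong_induction_on with
  | _ m ih =>
    rcases termCode_cases m with rfl | ⟨a, rfl⟩ | ⟨t, ht, rfl⟩ | ⟨s, hs, t, ht, rfl⟩
    · exact ⟨Term.func (L := groupLang) GroupFunc.zero Fin.elim0, rfl⟩
    · rw [evalCode_const] at h
      exact ⟨Term.var ⟨a, hU a h⟩, rfl⟩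
    · rw [evalCode_neg, Option.isSome_map] at h
      obtain ⟨τ, hτ⟩ := ih t ht h
      exact ⟨Term.func (L := groupLang) GroupFunc.neg ![τ], by rw [termCode, ← hτ]; rfl⟩
    · obtain ⟨z, hz⟩ := Option.isSome_iff_exists.1 h
      rw [evalCode_add, Option.bind_eq_some_iff] at hz
      obtain ⟨x, hx, hy⟩ := hz
      obtain ⟨y, hy, -⟩ := Option.map_eq_some_iff.1 hy
      obtain ⟨σ, hσ⟩ := ih s hs (by simp [hx])
      obtain ⟨τ, hτ⟩ := ih t ht (by simp [hy])
      exact ⟨Term.func (L := groupLang) GroupFunc.add ![σ, τ], by rw [termCode, ← hσ, ← hτ]; rfl⟩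

theorem atomicDiagram_eq_codeDiagram {U : Set ℕ} [groupLang.Structure U] (e : U ≃[groupLang] B)
    {ι : ℕ → Option B} (hv : ∀ a : U, ι a = some (e a)) (hU : ∀ a, (ι a).isSome → a ∈ U) :
    atomicDiagram U = codeDiagram ι := by
  have key : ∀ s t : groupLang.Term U, s.realize id = t.realize id ↔
      (s.realize fun a => e a) = t.realize fun a => e a := fun s t => by
    rw [← equiv_realize, ← equiv_realize, e.injective.eq_iff]
  ext m
  constructor
  · rintro ⟨s, t, ⟨h, rfl⟩ | ⟨h, rfl⟩⟩
    · rw [even_mem_codeDiagram, evalCode_termCode hv, evalCode_termCode hv]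
      exact ⟨_, rfl, by rw [(key s t).1 h]⟩
    · rw [odd_mem_codeDiagram, evalCode_termCode hv, evalCode_termCode hv]
      exact ⟨_, _, rfl, rfl, fun h' => h ((key s t).2 h')⟩
  · rintro ⟨x, y, hx, hy, hxy⟩
    obtain ⟨s, hs⟩ := exists_term_of_evalCode hU _ (by rw [hx]; rfl)
    obtain ⟨t, ht⟩ := exists_term_of_evalCode hU _ (by rw [hy]; rfl)
    rw [← hs, evalCode_termCode hv, Option.some_inj] at hx
    rw [← ht, evalCode_termCode hv, Option.some_inj] at hy
    refine ⟨s, t, ?_⟩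
    rw [hs, ht, Nat.pair_unpair, key s t, hx, hy, ne_eq, key s t, hx, hy, ← hxy]
    omega

/-- The atomic diagrams of the copies of `B` are the diagrams of its numberings. -/
theorem exists_structure_iff_exists_numbering (P : Set ℕ → Prop) :
    (∃ (U : Set ℕ) (_ : groupLang.Structure U),
      Nonempty (U ≃[groupLang] B) ∧ P (atomicDiagram U)) ↔
    ∃ ι : ℕ → Option B, IsNumbering ι ∧ P (codeDiagram ι) := by
  classical
  constructor
  · rintro ⟨U, _, ⟨e⟩, hP⟩
    set ι : ℕ → Option B := fun a => if h : a ∈ U then some (e ⟨a, h⟩) else none with hι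
    have hv : ∀ a : U, ι a = some (e a) := fun a => by simp [hι]
    have hU : ∀ a, (ι a).isSome → a ∈ U := fun a h => by
      by_contra ha
      simp [hι, ha] at h
    refine ⟨ι, ⟨fun a b x ha hb => ?_, fun x => ⟨e.symm x, by rw [hv]; simp⟩⟩,
      atomicDiagram_eq_codeDiagram e hv hU ▸ hP⟩
    have ha' := hU a (by simp [ha])
    have hb' := hU b (by simp [hb])
    rw [hv ⟨a, ha'⟩, Option.some_inj] at ha
    rw [hv ⟨b, hb'⟩, Option.some_inj] at hb
    exact congrArg Subtype.val (e.injective (ha.trans hb.symm))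
  · rintro ⟨ι, hι, hP⟩
    set U : Set ℕ := {a | (ι a).isSome} with hU
    have hbij : Function.Bijective fun a : U => (ι a).get a.2 := by
      constructor
      · intro a b hab
        refine Subtype.ext (hι.injective a b ((ι a).get a.2) (by simp) ?_)
        simp only at hab
        rw [hab]
        simp
      · intro x
        obtain ⟨a, ha⟩ := hι.surjective x
        exact ⟨⟨a, by simp [hU, ha]⟩, by simp [ha]⟩
    let e : U ≃ B := Equiv.ofBijective _ hbij
    let _ : groupLang.Structure U := e.symm.inducedStructure
    let e' : U ≃[groupLang] B := (e.symm.inducedStructureEquiv).symm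
    have hv : ∀ a : U, ι a = some (e' a) := fun a => by
      change ι a = some ((ι a).get a.2)
      simp
    exact ⟨U, _, ⟨e'⟩, (atomicDiagram_eq_codeDiagram e' hv fun a h => h).symm ▸ hP⟩

end Structures

/-! ### Primitive recursive functions and predicates -/

section Primrec

variable {α β γ : Type*} [Primcodable α] [Primcodable β] [Primcodable γ]

attribute [fun_prop] Primrec PrimrecPred

@[fun_prop] theorem primrec_id : Primrec (fun x : α => x) := Primrec.id

@[fun_prop] theorem primrec_const (b : β) : Primrec (fun _ : α => b) := Primrec.const b

@[fun_prop] theorem primrec_comp {f : β → γ} {g : α → β} (hf : Primrec f) (hg : Primrec g) :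
    Primrec (fun x => f (g x)) := hf.comp hg

@[fun_prop] theorem primrec_fst {g : α → β × γ} (hg : Primrec g) : Primrec (fun x => (g x).1) :=
  Primrec.fst.comp hg

@[fun_prop] theorem primrec_snd {g : α → β × γ} (hg : Primrec g) : Primrec (fun x => (g x).2) :=
  Primrec.snd.comp hg

@[fun_prop] theorem primrec_pair {f : α → β} {g : α → γ} (hf : Primrec f) (hg : Primrec g) :
    Primrec (fun x => (f x, g x)) := hf.pair hg

@[fun_prop] theorem primrec_natPair {f g : α → ℕ} (hf : Primrec f) (hg : Primrec g) :
    Primrec (fun x => Nat.pair (f x) (g x)) := Primrec₂.natPair.comp hf hg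

@[fun_prop] theorem primrec_unpair {f : α → ℕ} (hf : Primrec f) :
    Primrec (fun x => Nat.unpair (f x)) := Primrec.unpair.comp hf

@[fun_prop] theorem primrec_add {f g : α → ℕ} (hf : Primrec f) (hg : Primrec g) :
    Primrec (fun x => f x + g x) := Primrec.nat_add.comp hf hg

@[fun_prop] theorem primrec_mul {f g : α → ℕ} (hf : Primrec f) (hg : Primrec g) :
    Primrec (fun x => f x * g x) := Primrec.nat_mul.comp hf hg

@[fun_prop] theorem primrec_div {f g : α → ℕ} (hf : Primrec f) (hg : Primrec g) :
    Primrec (fun x => f x / g x) := Primrec.nat_div.comp hf hg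

@[fun_prop] theorem primrec_mod {f g : α → ℕ} (hf : Primrec f) (hg : Primrec g) :
    Primrec (fun x => f x % g x) := Primrec.nat_mod.comp hf hg

@[fun_prop] theorem primrec_ofNat {β : Type*} [Denumerable β] {f : α → ℕ} (hf : Primrec f) :
    Primrec (fun x => Denumerable.ofNat β (f x)) := (Primrec.ofNat β).comp hf

@[fun_prop] theorem primrec_encode {f : α → β} (hf : Primrec f) :
    Primrec (fun x => Encodable.encode (f x)) := Primrec.encode.comp hf

@[fun_prop] theorem primrecPred_comp {p : β → Prop} {g : α → β} (hp : PrimrecPred p)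
    (hg : Primrec g) : PrimrecPred (fun x => p (g x)) := hp.comp hg

@[fun_prop] theorem primrecPred_and {p q : α → Prop} (hp : PrimrecPred p) (hq : PrimrecPred q) :
    PrimrecPred (fun x => p x ∧ q x) := hp.and hq

@[fun_prop] theorem primrecPred_or {p q : α → Prop} (hp : PrimrecPred p) (hq : PrimrecPred q) :
    PrimrecPred (fun x => p x ∨ q x) := hp.or hq

@[fun_prop] theorem primrecPred_not {p : α → Prop} (hp : PrimrecPred p) :
    PrimrecPred (fun x => ¬ p x) := hp.not

@[fun_prop] theorem primrecPred_eq {f g : α → β} (hf : Primrec f) (hg : Primrec g) :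
    PrimrecPred (fun x => f x = g x) := by
  classical
  exact Primrec.eq.comp hf hg

@[fun_prop] theorem primrecPred_lt {f g : α → ℕ} (hf : Primrec f) (hg : Primrec g) :
    PrimrecPred (fun x => f x < g x) := Primrec.nat_lt.comp hf hg

@[fun_prop] theorem primrec_decide {p : α → Prop} [DecidablePred p] (hp : PrimrecPred p) :
    Primrec (fun x => decide (p x)) := hp.decide

@[fun_prop] theorem primrec_ite {f g : α → β} {p : α → Prop} [DecidablePred p]
    (hp : PrimrecPred p) (hf : Primrec f) (hg : Primrec g) :
    Primrec (fun x => if p x then f x else g x) := Primrec.ite hp hf hg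

end Primrec

/-! ### Projections of primitive recursive predicates -/

/-- `Σ⁰₁` predicates, as projections of primitive recursive ones. -/
def Sigma1 {α : Type*} [Primcodable α] (P : α → Prop) : Prop :=
  ∃ R : α × ℕ → Prop, PrimrecPred R ∧ ∀ a, P a ↔ ∃ k, R (a, k)

namespace Sigma1

variable {α β : Type*} [Primcodable α]

theorem of_primrecPred {P : α → Prop} (hP : PrimrecPred P) : Sigma1 P :=
  ⟨fun p => P p.1, by fun_prop, fun a => by simp⟩

theorem comp [Primcodable β] {P : β → Prop} (hP : Sigma1 P) {f : α → β} (hf : Primrec f) :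
    Sigma1 fun a => P (f a) := by
  obtain ⟨R, hR, h⟩ := hP
  exact ⟨fun p => R (f p.1, p.2), by fun_prop, fun a => h (f a)⟩

theorem and {P Q : α → Prop} (hP : Sigma1 P) (hQ : Sigma1 Q) : Sigma1 fun a => P a ∧ Q a := by
  obtain ⟨R, hR, h⟩ := hP
  obtain ⟨R', hR', h'⟩ := hQ
  refine ⟨fun p => R (p.1, p.2.unpair.1) ∧ R' (p.1, p.2.unpair.2), by fun_prop, fun a => ?_⟩
  simp only [h, h']
  constructor
  · rintro ⟨⟨k, hk⟩, l, hl⟩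
    exact ⟨Nat.pair k l, by simpa using ⟨hk, hl⟩⟩
  · rintro ⟨k, hk, hl⟩
    exact ⟨⟨_, hk⟩, _, hl⟩

theorem or {P Q : α → Prop} (hP : Sigma1 P) (hQ : Sigma1 Q) : Sigma1 fun a => P a ∨ Q a := by
  obtain ⟨R, hR, h⟩ := hP
  obtain ⟨R', hR', h'⟩ := hQ
  refine ⟨fun p => R p ∨ R' p, by fun_prop, fun a => ?_⟩
  simp only [h, h', exists_or]

theorem exists_of [Denumerable β] {P : α → β → Prop} (hP : Sigma1 fun p : α × β => P p.1 p.2) :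
    Sigma1 fun a => ∃ b, P a b := by
  obtain ⟨R, hR, h⟩ := hP
  refine ⟨fun p => R ((p.1, Denumerable.ofNat β p.2.unpair.1), p.2.unpair.2), by fun_prop,
    fun a => ?_⟩
  constructor
  · rintro ⟨b, hb⟩
    obtain ⟨k, hk⟩ := (h (a, b)).1 hb
    exact ⟨Nat.pair (Encodable.encode b) k, by simpa using hk⟩
  · rintro ⟨k, hk⟩
    exact ⟨_, (h (a, _)).2 ⟨_, hk⟩⟩

/-- Normal form: halting within `k` steps is primitive recursive. -/
theorem of_rePred {P : α → Prop} (hP : REPred P) : Sigma1 P := by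
  obtain ⟨c, hc⟩ := Nat.Partrec.Code.exists_code.1 hP
  refine ⟨fun p => ((c.evaln p.2 (Encodable.encode p.1)).isSome : Prop), ?_, fun a => ?_⟩
  · have h1 : Primrec fun p : α × ℕ => c.evaln p.2 (Encodable.encode p.1) :=
      Nat.Partrec.Code.primrec_evaln.comp
        (f := fun a : (ℕ × Nat.Partrec.Code) × ℕ => Nat.Partrec.Code.evaln a.1.1 a.1.2 a.2)
        (g := fun p : α × ℕ => ((p.2, c), Encodable.encode p.1)) (by fun_prop)
    have h2 : PrimrecPred fun p : α × ℕ =>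
        (c.evaln p.2 (Encodable.encode p.1)).isSome = true :=
      Primrec.eq.comp (Primrec.option_isSome.comp h1) (Primrec.const true)
    exact h2
  · have h1 : (c.eval (Encodable.encode a)).Dom ↔ P a := by
      rw [hc]
      simp [Part.assert]
    rw [← h1, Part.dom_iff_mem]
    simp only [Nat.Partrec.Code.evaln_complete, Option.isSome_iff_exists, Option.mem_def]
    exact exists_comm

end Sigma1

theorem primrec_evaln_ofNat : Primrec fun p : ℕ × ℕ × ℕ =>
    (Denumerable.ofNat Nat.Partrec.Code p.2.1).evaln p.1 p.2.2 :=
  Nat.Partrec.Code.primrec_evaln.comp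
    (f := fun a : (ℕ × Nat.Partrec.Code) × ℕ => Nat.Partrec.Code.evaln a.1.1 a.1.2 a.2)
    (g := fun p : ℕ × ℕ × ℕ => ((p.1, Denumerable.ofNat Nat.Partrec.Code p.2.1), p.2.2))
    (by fun_prop)

theorem Sigma1.mem_phi {α : Type*} [Primcodable α] (y : ℕ) {f g : α → ℕ} (hf : Primrec f)
    (hg : Primrec g) : Sigma1 fun a => y ∈ phi (f a) (g a) := by
  refine ⟨fun p => (Denumerable.ofNat Nat.Partrec.Code (f p.1)).evaln p.2 (g p.1) = some y, ?_,
    fun a => Nat.Partrec.Code.evaln_complete⟩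
  have := primrec_evaln_ofNat
  have h2 : Primrec fun p : α × ℕ =>
      (Denumerable.ofNat Nat.Partrec.Code (f p.1)).evaln p.2 (g p.1) :=
    this.comp (g := fun p : α × ℕ => (p.2, f p.1, g p.1)) (by fun_prop)
  fun_prop

theorem isSigma02_of_sigma1 {P : ℕ × ℕ → Prop} (hP : Sigma1 P) :
    IsSigma02 {n | ∃ x, ¬ P (n, x)} := by
  obtain ⟨R, hR, h⟩ := hP
  refine ⟨fun p => ¬ R ((p.1, p.2.1), p.2.2), PrimrecPred.computablePred (by fun_prop), fun n => ?_⟩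
  simp only [Set.mem_ofPred_eq, h, not_exists]

/-- The negation of the computable matrix is c.e., so the matrix itself is a universal quantifier
over a primitive recursive predicate. That quantifier is merged with the one over `y` by pairing. -/
theorem IsSigma02.exists_primrecPred {S : Set ℕ} (hS : IsSigma02 S) :
    ∃ R : ℕ × ℕ × ℕ → Prop, PrimrecPred R ∧ ∀ n, n ∈ S ↔ ∃ x, ∀ y, R (n, x, y) := by
  obtain ⟨R, hR, h⟩ := hS
  obtain ⟨Q, hQ, hQR⟩ := Sigma1.of_rePred hR.not.to_re
  refine ⟨fun p => ¬ Q ((p.1, p.2.1, p.2.2.unpair.1), p.2.2.unpair.2), by fun_prop, fun n => ?_⟩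
  rw [h]
  refine exists_congr fun x => ⟨fun hx y hy => ?_, fun hx y => ?_⟩
  · exact (hQR _).2 ⟨_, hy⟩ (hx _)
  · by_contra hc
    obtain ⟨k, hk⟩ := (hQR _).1 hc
    exact hx (Nat.pair y k) (by simpa using hk)

/-- `Π⁰₂` sets of natural numbers. -/
def IsPi02 (S : Set ℕ) : Prop := ∃ P : ℕ × ℕ → Prop, Sigma1 P ∧ ∀ n, n ∈ S ↔ ∀ x, P (n, x)

namespace IsPi02

theorem of_forall {β : Type*} [Denumerable β] {P : ℕ → β → Prop}
    (hP : Sigma1 fun p : ℕ × β => P p.1 p.2) : IsPi02 {n | ∀ b, P n b} :=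
  ⟨fun p => P p.1 (Denumerable.ofNat β p.2),
    hP.comp (f := fun p : ℕ × ℕ => (p.1, Denumerable.ofNat β p.2)) (by fun_prop), fun n =>
    ⟨fun h x => h _, fun h b => by simpa using h (Encodable.encode b)⟩⟩

theorem inter {S T : Set ℕ} (hS : IsPi02 S) (hT : IsPi02 T) : IsPi02 (S ∩ T) := by
  obtain ⟨P, hP, h⟩ := hS
  obtain ⟨Q, hQ, h'⟩ := hT
  exact ⟨fun p => P p ∧ Q p, hP.and hQ, fun n => by rw [Set.mem_inter_iff, h, h', forall_and]⟩

theorem compl {S : Set ℕ} (hS : IsPi02 S) : IsSigma02 Sᶜ := by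
  obtain ⟨P, hP, h⟩ := hS
  have : Sᶜ = {n | ∃ x, ¬ P (n, x)} := by
    ext n
    rw [Set.mem_compl_iff, h, Set.mem_ofPred_eq, not_forall]
  exact this ▸ isSigma02_of_sigma1 hP

end IsPi02

theorem exists_phi_eq {f : ℕ →. ℕ} (hf : Nat.Partrec f) : ∃ e, phi e = f := by
  obtain ⟨c, hc⟩ := Nat.Partrec.Code.exists_code.1 hf
  exact ⟨Encodable.encode c, by rw [phi, Denumerable.ofNat_encode, hc]⟩

/-- Supplies indices of infinite conjunctions and disjunctions from primitive recursive lists of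
codes. The function with this domain searches for a preimage. -/
theorem exists_W_eq_range {f : ℕ → ℕ} (hf : Primrec f) : ∃ e, W e = Set.range f := by
  have h1 : Partrec fun n : ℕ => Nat.rfind fun k => Part.some (decide (f k = n)) :=
    Partrec.rfind (Primrec.to_comp (f := fun p : ℕ × ℕ => decide (f p.2 = p.1))
      (by fun_prop)).partrec.to₂
  obtain ⟨e, he⟩ := exists_phi_eq (Partrec.nat_iff.1 h1)
  refine ⟨e, Set.ext fun n => ?_⟩
  rw [W, Set.mem_ofPred_eq, he, Part.dom_iff_mem]
  constructor
  · rintro ⟨k, hk⟩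
    exact ⟨k, by simpa using Nat.rfind_spec hk⟩
  · rintro ⟨k, hk⟩
    rw [← Part.dom_iff_mem]
    refine Nat.rfind_dom'.2 ?_
    exact ⟨k, by simpa using hk, fun _ => trivial⟩

/-! ### Structures for the language of groups and additive groups -/

section Structures

open FirstOrder Language

theorem structure_ext {A : Type*} {i j : groupLang.Structure A}
    (h0 : ∀ x, i.funMap GroupFunc.zero x = j.funMap GroupFunc.zero x)
    (hn : ∀ x, i.funMap GroupFunc.neg x = j.funMap GroupFunc.neg x)
    (ha : ∀ x, i.funMap GroupFunc.add x = j.funMap GroupFunc.add x) : i = j := by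
  refine Structure.ext ?_ ?_
  · funext n f x
    match n, f, x with
    | _, GroupFunc.zero, x => exact h0 x
    | _, GroupFunc.neg, x => exact hn x
    | _, GroupFunc.add, x => exact ha x
  · funext n r
    exact nomatch r

theorem exists_addCommGroup {A : Type*} [i : groupLang.Structure A] {z : A} {ng : A → A}
    {ad : A → A → A} (h0 : ∀ x, i.funMap GroupFunc.zero x = z)
    (hn : ∀ x, i.funMap GroupFunc.neg x = ng (x 0))
    (ha : ∀ x, i.funMap GroupFunc.add x = ad (x 0) (x 1))
    (assoc : ∀ x y w, ad (ad x y) w = ad x (ad y w)) (zero_add : ∀ x, ad z x = x)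
    (neg_add : ∀ x, ad (ng x) x = z) (comm : ∀ x y, ad x y = ad y x) :
    ∃ g : AddCommGroup A, i = @instStructureOfAddGroup A g.toAddGroup := by
  let _ : Zero A := ⟨z⟩
  let _ : Neg A := ⟨ng⟩
  let _ : Add A := ⟨ad⟩
  let g : AddCommGroup A := { AddGroup.ofLeftAxioms assoc zero_add neg_add with add_comm := comm }
  exact ⟨g, structure_ext h0 hn ha⟩

theorem exists_addCommGroup_of_equiv {A G : Type*} [i : groupLang.Structure A] [AddCommGroup G]
    (e : A ≃[groupLang] G) : ∃ g : AddCommGroup A, i = @instStructureOfAddGroup A g.toAddGroup ∧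
      Nonempty (A ≃+ G) := by
  let g : AddCommGroup A := e.toEquiv.addCommGroup
  refine ⟨g, structure_ext (fun x => ?_) (fun x => ?_) (fun x => ?_), ⟨e.toEquiv.addEquiv⟩⟩
  · apply e.injective
    exact (e.map_fun GroupFunc.zero x).trans (e.apply_symm_apply (0 : G)).symm
  · apply e.injective
    exact (e.map_fun GroupFunc.neg x).trans (e.apply_symm_apply (-(e (x 0)) : G)).symm
  · apply e.injective
    exact (e.map_fun GroupFunc.add x).trans (e.apply_symm_apply (e (x 0) + e (x 1) : G)).symm

theorem nonempty_equiv_of_addEquiv {A G : Type*} [AddGroup A] [AddGroup G] (e : A ≃+ G) :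
    Nonempty (A ≃[groupLang] G) := by
  refine ⟨⟨e.toEquiv, fun {n} f x => ?_, fun {n} r => nomatch r⟩⟩
  match n, f, x with
  | _, GroupFunc.zero, x => exact map_zero e
  | _, GroupFunc.neg, x => exact map_neg e (x 0)
  | _, GroupFunc.add, x => exact map_add e (x 0) (x 1)

end Structures

/-! ### Terms and their codes -/

section Terms

open FirstOrder Language

variable {α : Type*}

/-- The term `0`. -/
def zeroTerm : groupLang.Term α := .func GroupFunc.zero Fin.elim0

/-- The term `-t`. -/
def negTerm (t : groupLang.Term α) : groupLang.Term α := .func GroupFunc.neg ![t]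

/-- The term `s + t`. -/
def addTerm (s t : groupLang.Term α) : groupLang.Term α := .func GroupFunc.add ![s, t]

/-- The term `k • t`. -/
def smulTerm (k : ℕ) (t : groupLang.Term α) : groupLang.Term α :=
  k.rec zeroTerm fun _ s => addTerm s t

/-- The Goedel number of `k • t`, where `t` is the Goedel number of a term. -/
def smulCode (k t : ℕ) : ℕ := k.rec 0 fun _ s => 3 * Nat.pair s t + 3

@[fun_prop] theorem primrec_smulCode {β : Type*} [Primcodable β] {f g : β → ℕ} (hf : Primrec f)
    (hg : Primrec g) : Primrec fun x => smulCode (f x) (g x) :=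
  Primrec.nat_rec' (f := f) (g := fun _ => 0) (h := fun x p => 3 * Nat.pair p.2 (g x) + 3) hf
    (by fun_prop) (by unfold Primrec₂; fun_prop)

theorem termCode_negTerm (v : α → ℕ) (t : groupLang.Term α) :
    termCode v (negTerm t) = 3 * termCode v t + 2 := rfl

theorem termCode_addTerm (v : α → ℕ) (s t : groupLang.Term α) :
    termCode v (addTerm s t) = 3 * Nat.pair (termCode v s) (termCode v t) + 3 := rfl

theorem termCode_smulTerm (v : α → ℕ) (k : ℕ) (t : groupLang.Term α) :
    termCode v (smulTerm k t) = smulCode k (termCode v t) := by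
  induction k with
  | zero => rfl
  | succ k ih =>
    change termCode v (addTerm (smulTerm k t) t) = 3 * Nat.pair (smulCode k (termCode v t)) _ + 3
    rw [termCode_addTerm, ih]

theorem realize_zeroTerm {A : Type*} [AddGroup A] (v : α → A) :
    (zeroTerm : groupLang.Term α).realize v = 0 := rfl

theorem realize_negTerm {A : Type*} [AddGroup A] (v : α → A) (t : groupLang.Term α) :
    (negTerm t).realize v = -t.realize v := rfl

theorem realize_smulTerm {A : Type*} [AddGroup A] (v : α → A) (k : ℕ) (t : groupLang.Term α) :
    (smulTerm k t).realize v = k • t.realize v := by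
  induction k with
  | zero => exact (zero_nsmul _).symm
  | succ k ih =>
    rw [succ_nsmul, ← ih]
    rfl

end Terms

/-! ### Families of computable formulas -/

section Formulas

variable {A : Type*} [groupLang.Structure A]

theorem satSigma_zero {n : ℕ} (φ : QF n) (v : Fin n → A) :
    SatSigma 0 n φ.code v ↔ φ.Realize v := by
  rw [SatSigma]
  exact ⟨fun ⟨ψ, h, hψ⟩ => QF.code_injective h ▸ hψ, fun h => ⟨φ, rfl, h⟩⟩

theorem satPi_zero {n : ℕ} (φ : QF n) (v : Fin n → A) : SatPi 0 n φ.code v ↔ φ.Realize v := by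
  rw [SatPi]
  exact ⟨fun ⟨ψ, h, hψ⟩ => QF.code_injective h ▸ hψ, fun h => ⟨φ, rfl, h⟩⟩

theorem isIndex_zero {n : ℕ} (φ : QF n) : IsIndex 0 n φ.code := by
  rw [IsIndex]
  exact ⟨φ, rfl⟩

theorem pair_eq_triple {a b c a' b' c' : ℕ} :
    Nat.pair a (Nat.pair b c) = Nat.pair a' (Nat.pair b' c') ↔ a = a' ∧ b = b' ∧ c = c' := by
  rw [Nat.pair_eq_pair, Nat.pair_eq_pair]

theorem isIndex_one {n k e : ℕ} {φ : ℕ → QF (n + k)}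
    (he : W e = Set.range fun i => Nat.pair 0 (Nat.pair k (φ i).code)) : IsIndex 1 n e := by
  rw [IsIndex]
  intro m hm
  obtain ⟨i, rfl⟩ := he ▸ hm
  exact ⟨0, one_pos, k, _, rfl, isIndex_zero _⟩

theorem satSigma_one {n k e : ℕ} {φ : ℕ → QF (n + k)}
    (he : W e = Set.range fun i => Nat.pair 0 (Nat.pair k (φ i).code)) (v : Fin n → A) :
    SatSigma 1 n e v ↔ ∃ i, ∃ y : Fin k → A, (φ i).Realize (Fin.append v y) := by
  rw [SatSigma, he]
  constructor
  · rintro ⟨β, -, k', j, ⟨i, hi⟩, y, hy⟩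
    obtain ⟨rfl, rfl, rfl⟩ := pair_eq_triple.1 hi
    exact ⟨i, y, (satPi_zero _ _).1 hy⟩
  · rintro ⟨i, y, hy⟩
    exact ⟨0, one_pos, k, _, ⟨i, rfl⟩, y, (satPi_zero _ _).2 hy⟩

theorem satPi_one {n k e : ℕ} {φ : ℕ → QF (n + k)}
    (he : W e = Set.range fun i => Nat.pair 0 (Nat.pair k (φ i).code)) (v : Fin n → A) :
    SatPi 1 n e v ↔ ∀ i, ∀ y : Fin k → A, (φ i).Realize (Fin.append v y) := by
  rw [SatPi, he]
  constructor
  · intro h i y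
    exact (satSigma_zero _ _).1 (h 0 one_pos k _ ⟨i, rfl⟩ y)
  · rintro h β - k' j ⟨i, hi⟩ y
    obtain ⟨rfl, rfl, rfl⟩ := pair_eq_triple.1 hi
    exact (satSigma_zero _ _).2 (h i y)

end Formulas

/-! ### The Scott sentence -/

section Scott

open FirstOrder Language

/-- `x₀ ≠ 0`, and `m • x₁ ≠ x₀` if `m > 1` and `a * m = b * N + 1`, where `i` codes `(m, a, b)`. -/
def indivisibleQF (N i : ℕ) : QF (0 + 1 + 1) :=
  .and (.ne (.var 0) zeroTerm)
    -- For an `i` that codes no admissible triple the inequality becomes `0 ≠ x₀`, which the first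
    -- conjunct already asserts. The family is thus indexed by all natural numbers.
    (.ne (if 1 < i.unpair.1 ∧ i.unpair.2.unpair.1 * i.unpair.1 = i.unpair.2.unpair.2 * N + 1
      then smulTerm i.unpair.1 (.var 1) else zeroTerm) (.var 0))

/-- `N • x₁ = x₀`. -/
def divisibleQF (N : ℕ) : QF (0 + 1 + 1) := .eq (smulTerm N (.var 1)) (.var 0)

/-- `(m + 1) • x₁ = n • x₀`, or `(m + 1) • x₁ = -(n • x₀)`, or `x₀ = 0`, where `i` codes
`(m, n)`. -/
def commensurableQF (i : ℕ) : QF (0 + 2 + 0) :=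
  .or (.eq (smulTerm (i.unpair.1 + 1) (.var 1)) (smulTerm i.unpair.2 (.var 0)))
    (.or (.eq (smulTerm (i.unpair.1 + 1) (.var 1)) (negTerm (smulTerm i.unpair.2 (.var 0))))
      (.eq (.var 0) zeroTerm))

/-- The axioms of abelian groups. -/
def groupQF : QF (0 + 3) :=
  .and (.eq (addTerm (addTerm (.var 0) (.var 1)) (.var 2))
      (addTerm (.var 0) (addTerm (.var 1) (.var 2))))
    (.and (.eq (addTerm zeroTerm (.var 0)) (.var 0))
      (.and (.eq (addTerm (negTerm (.var 0)) (.var 0)) zeroTerm)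
        (.eq (addTerm (.var 0) (.var 1)) (addTerm (.var 1) (.var 0)))))

/-- The axioms of abelian groups, and `(m + 1) • x₀ = 0 → x₀ = 0`. -/
def torsionFreeQF (m : ℕ) : QF (0 + 3) :=
  .and groupQF (.or (.ne (smulTerm (m + 1) (.var 0)) zeroTerm) (.eq (.var 0) zeroTerm))

/-- In the explicit codes here and below, 1 and 4 stand for the variables `x₀` and `x₁`, and 0 for
the term `0`. -/
theorem primrec_code_indivisibleQF (N : ℕ) : Primrec fun i => (indivisibleQF N i).code := by
  have : (fun i => (indivisibleQF N i).code) = fun i => 4 * Nat.pair (4 * Nat.pair 1 0 + 1)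
      (4 * Nat.pair (if 1 < i.unpair.1 ∧
        i.unpair.2.unpair.1 * i.unpair.1 = i.unpair.2.unpair.2 * N + 1
        then smulCode i.unpair.1 4 else 0) 1 + 1) + 2 := by
    funext i
    rw [indivisibleQF, QF.code, QF.code, QF.code]
    split_ifs
    · rw [termCode_smulTerm]; rfl
    · rfl
  rw [this]
  fun_prop

theorem primrec_code_commensurableQF : Primrec fun i => (commensurableQF i).code := by
  have : (fun i => (commensurableQF i).code) = fun i =>
      4 * Nat.pair (4 * Nat.pair (smulCode (i.unpair.1 + 1) 4) (smulCode i.unpair.2 1))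
        (4 * Nat.pair (4 * Nat.pair (smulCode (i.unpair.1 + 1) 4) (3 * smulCode i.unpair.2 1 + 2))
          (4 * Nat.pair 1 0) + 3) + 3 := by
    funext i
    simp only [commensurableQF, QF.code, termCode_smulTerm, termCode_negTerm]
    rfl
  rw [this]
  fun_prop

theorem primrec_code_torsionFreeQF : Primrec fun m => (torsionFreeQF m).code := by
  have : (fun m => (torsionFreeQF m).code) = fun m =>
      4 * Nat.pair groupQF.code
        (4 * Nat.pair (4 * Nat.pair (smulCode (m + 1) 1) 0 + 1) (4 * Nat.pair 1 0) + 3) + 2 := by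
    funext i
    simp only [torsionFreeQF, QF.code, termCode_smulTerm]
    rfl
  rw [this]
  fun_prop

/-- The numbers `m`, `a`, `b` range over an infinite conjunction, so only `x` and `y` are
quantified: one existential in front of a computable `Π₁` formula. -/
theorem exists_sigma2_sentence (N : ℕ) : ∃ σ, IsIndex 2 0 σ ∧ ∀ (A : Type) [AddCommGroup A],
    SatSigma 2 0 σ (Fin.elim0 : Fin 0 → A) ↔ ∃ x : A, x ≠ 0 ∧
      ∀ (m a b : ℕ) (y : A), 1 < m → a * m = b * N + 1 → m • y ≠ x := by
  obtain ⟨j, hj⟩ := exists_W_eq_range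
    (f := fun i => Nat.pair 0 (Nat.pair 1 (indivisibleQF N i).code)) (by
      have := primrec_code_indivisibleQF N
      fun_prop)
  obtain ⟨σ, hσ⟩ := exists_W_eq_range (f := fun _ => Nat.pair 1 (Nat.pair 1 j)) (by fun_prop)
  rw [Set.range_const] at hσ
  refine ⟨σ, ?_, fun A _ => ?_⟩
  · rw [IsIndex]
    intro m hm
    rw [hσ, Set.mem_singleton_iff] at hm
    exact ⟨1, by omega, 1, j, hm, isIndex_one hj⟩
  · have h1 : SatSigma 2 0 σ (Fin.elim0 : Fin 0 → A) ↔
        ∃ x : Fin 1 → A, SatPi 1 (0 + 1) j (Fin.append Fin.elim0 x) := by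
      rw [SatSigma, hσ]
      constructor
      · rintro ⟨β, -, k', j', hi, y, hy⟩
        obtain ⟨rfl, rfl, rfl⟩ := pair_eq_triple.1 hi
        exact ⟨y, hy⟩
      · rintro ⟨y, hy⟩
        exact ⟨1, by omega, 1, j, rfl, y, hy⟩
    rw [h1]
    simp only [satPi_one hj]
    have key : ∀ (i : ℕ) (x y : Fin 1 → A),
        (indivisibleQF N i).Realize (Fin.append (Fin.append Fin.elim0 x) y) ↔
        x 0 ≠ 0 ∧ ((1 < i.unpair.1 ∧
          i.unpair.2.unpair.1 * i.unpair.1 = i.unpair.2.unpair.2 * N + 1) →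
            i.unpair.1 • y 0 ≠ x 0) := by
      intro i x y
      simp only [indivisibleQF, QF.Realize, realize_zeroTerm]
      change x 0 ≠ 0 ∧ _ ≠ x 0 ↔ _
      refine and_congr_right fun hx => ?_
      split_ifs with h
      · rw [realize_smulTerm]
        exact ⟨fun h' _ => h', fun h' => h' h⟩
      · exact ⟨fun _ h' => absurd h' h, fun _ => hx.symm⟩
    simp only [key]
    constructor
    · rintro ⟨x, hx⟩
      refine ⟨x 0, (hx 0 x).1, fun m a b y hm hab => ?_⟩
      have := (hx (Nat.pair m (Nat.pair a b)) fun _ => y).2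
      simp only [Nat.unpair_pair] at this
      exact this ⟨hm, hab⟩
    · rintro ⟨x, hx, h⟩
      exact ⟨fun _ => x, fun i y => ⟨hx, fun h' => h _ _ _ _ h'.1 h'.2⟩⟩

theorem exists_primrec_range_eq_insert (a : ℕ) {f : ℕ → ℕ} (hf : Primrec f) :
    ∃ g : ℕ → ℕ, Primrec g ∧ Set.range g = insert a (Set.range f) := by
  refine ⟨fun n => Nat.casesOn n a f, Primrec.nat_casesOn₁ a hf, Set.ext fun m => ?_⟩
  constructor
  · rintro ⟨_ | n, rfl⟩
    · exact .inl rfl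
    · exact .inr ⟨n, rfl⟩
  · rintro (rfl | ⟨n, rfl⟩)
    · exact ⟨0, rfl⟩
    · exact ⟨n + 1, rfl⟩

theorem exists_addCommGroup_of_groupQF {A : Type*} [i : groupLang.Structure A]
    (h : ∀ x : Fin 3 → A, groupQF.Realize (Fin.append Fin.elim0 x)) :
    ∃ g : AddCommGroup A, i = @instStructureOfAddGroup A g.toAddGroup := by
  have h0 : ∀ x : Fin 0 → A, i.funMap GroupFunc.zero x = i.funMap GroupFunc.zero Fin.elim0 :=
    fun x => congrArg _ (funext fun a => a.elim0)
  have hn : ∀ x : Fin 1 → A, i.funMap GroupFunc.neg x = i.funMap GroupFunc.neg ![x 0] :=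
    fun x => congrArg _ (funext fun a => by fin_cases a; rfl)
  have ha : ∀ x : Fin 2 → A, i.funMap GroupFunc.add x = i.funMap GroupFunc.add ![x 0, x 1] :=
    fun x => congrArg _ (funext fun a => by fin_cases a <;> rfl)
  have hz : ∀ v : Fin (0 + 3) → A, (zeroTerm : groupLang.Term _).realize v =
      i.funMap GroupFunc.zero Fin.elim0 := fun v => h0 _
  have hng : ∀ (v : Fin (0 + 3) → A) (t : groupLang.Term _), (negTerm t).realize v =
      i.funMap GroupFunc.neg ![t.realize v] := fun v t => hn _
  have had : ∀ (v : Fin (0 + 3) → A) (s t : groupLang.Term _), (addTerm s t).realize v =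
      i.funMap GroupFunc.add ![s.realize v, t.realize v] := fun v s t => ha _
  simp only [groupQF, QF.Realize, hz, hng, had] at h
  exact exists_addCommGroup (ng := fun x => i.funMap GroupFunc.neg ![x])
    (ad := fun x y => i.funMap GroupFunc.add ![x, y]) h0 hn ha
    (fun x y w => (h ![x, y, w]).1) (fun x => (h fun _ => x).2.1)
    (fun x => (h fun _ => x).2.2.1) (fun x y => (h ![x, y, x]).2.2.2)

/-- Divisibility and rank one are universal statements about `Σ₁` formulas, the latter through an
infinite disjunction; torsion-freeness is one universal conjunct for each `m`. The group axioms are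
repeated inside each of these conjuncts. They have to be extracted from an arbitrary structure
before the remaining clauses can be read as statements about a group. -/
theorem exists_pi2_sentence (N : ℕ) : ∃ π, IsIndex 2 0 π ∧
    (∀ (A : Type) [i : groupLang.Structure A], SatPi 2 0 π (Fin.elim0 : Fin 0 → A) →
      ∃ g : AddCommGroup A, i = @instStructureOfAddGroup A g.toAddGroup) ∧
    ∀ (A : Type) [AddCommGroup A], SatPi 2 0 π (Fin.elim0 : Fin 0 → A) ↔
      (∀ x : A, ∃ y, N • y = x) ∧
      (∀ x y : A, ∃ m n : ℕ, (m + 1) • y = n • x ∨ (m + 1) • y = -(n • x) ∨ x = 0) ∧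
      ∀ (m : ℕ) (x : A), (m + 1) • x = 0 → x = 0 := by
  obtain ⟨j, hj⟩ := exists_W_eq_range
    (f := fun i => Nat.pair 0 (Nat.pair 1 (divisibleQF N).code)) (by fun_prop)
  obtain ⟨l, hl⟩ := exists_W_eq_range
    (f := fun i => Nat.pair 0 (Nat.pair 0 (commensurableQF i).code)) (by
      have := primrec_code_commensurableQF
      fun_prop)
  obtain ⟨f, hf, hfr⟩ := exists_primrec_range_eq_insert (Nat.pair 1 (Nat.pair 1 j))
    (primrec_natPair (primrec_const 0) (primrec_natPair (primrec_const 3)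
      primrec_code_torsionFreeQF))
  obtain ⟨f', hf', hfr'⟩ := exists_primrec_range_eq_insert (Nat.pair 1 (Nat.pair 2 l)) hf
  obtain ⟨π, hπ⟩ := exists_W_eq_range hf'
  rw [hfr', hfr] at hπ
  have hsat : ∀ (A : Type) [groupLang.Structure A], SatPi 2 0 π (Fin.elim0 : Fin 0 → A) ↔
      (∀ x : Fin 1 → A, SatSigma 1 (0 + 1) j (Fin.append Fin.elim0 x)) ∧
      (∀ x : Fin 2 → A, SatSigma 1 (0 + 2) l (Fin.append Fin.elim0 x)) ∧
      ∀ (m : ℕ) (x : Fin 3 → A), (torsionFreeQF m).Realize (Fin.append Fin.elim0 x) := by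
    intro A _
    rw [SatPi, hπ]
    constructor
    · intro h
      exact ⟨h 1 (by omega) 1 j (.inr (.inl rfl)), h 1 (by omega) 2 l (.inl rfl),
        fun m x => (satSigma_zero _ _).1 (h 0 (by omega) 3 _ (.inr (.inr ⟨m, rfl⟩)) x)⟩
    · rintro ⟨h1, h2, h3⟩ β - k i (hn | hn | ⟨n, hn⟩) y
      · obtain ⟨rfl, rfl, rfl⟩ := pair_eq_triple.1 hn
        exact h2 y
      · obtain ⟨rfl, rfl, rfl⟩ := pair_eq_triple.1 hn
        exact h1 y
      · obtain ⟨rfl, rfl, rfl⟩ := pair_eq_triple.1 hn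
        exact (satSigma_zero _ _).2 (h3 n y)
  refine ⟨π, ?_, fun A i h => exists_addCommGroup_of_groupQF fun x =>
    (((hsat A).1 h).2.2 0 x).1, fun A _ => ?_⟩
  · rw [IsIndex, hπ]
    rintro _ (rfl | rfl | ⟨n, rfl⟩)
    · exact ⟨1, by omega, 2, l, rfl, isIndex_one hl⟩
    · exact ⟨1, by omega, 1, j, rfl, isIndex_one hj⟩
    · exact ⟨0, by omega, 3, _, rfl, isIndex_zero _⟩
  · rw [hsat]
    simp only [satSigma_one hj, satSigma_one hl]
    refine and_congr ?_ (and_congr ?_ ?_)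
    · have key : ∀ x y : Fin 1 → A,
          (divisibleQF N).Realize (Fin.append (Fin.append Fin.elim0 x) y) ↔ N • y 0 = x 0 := by
        intro x y
        simp only [divisibleQF, QF.Realize, realize_smulTerm]
        rfl
      simp only [key, exists_const]
      exact ⟨fun h x => (h fun _ => x).imp' (fun y : Fin 1 → A => y 0) fun _ h => h,
        fun h x => (h (x 0)).imp' (fun y _ => y) fun _ h => h⟩
    · have key : ∀ (i : ℕ) (x : Fin 2 → A) (y : Fin 0 → A),
          (commensurableQF i).Realize (Fin.append (Fin.append Fin.elim0 x) y) ↔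
          (i.unpair.1 + 1) • x 1 = i.unpair.2 • x 0 ∨
          (i.unpair.1 + 1) • x 1 = -(i.unpair.2 • x 0) ∨ x 0 = 0 := by
        intro i x y
        simp only [commensurableQF, QF.Realize, realize_smulTerm, realize_negTerm]
        rfl
      simp only [key, exists_const]
      constructor
      · intro h x y
        obtain ⟨i, hi⟩ := h ![x, y]
        exact ⟨_, _, hi⟩
      · intro h x
        obtain ⟨m, n, hmn⟩ := h (x 0) (x 1)
        exact ⟨Nat.pair m n, by simpa using hmn⟩
    · have key : ∀ (m : ℕ) (x : Fin 3 → A),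
          (torsionFreeQF m).Realize (Fin.append Fin.elim0 x) ↔ ((m + 1) • x 0 = 0 → x 0 = 0) := by
        intro m x
        simp only [torsionFreeQF, QF.Realize, realize_smulTerm]
        rw [← imp_iff_not_or, and_iff_right]
        · rfl
        · exact ⟨add_assoc _ _ _, zero_add _, neg_add_cancel _, add_comm _ _⟩
      simp only [key]
      exact ⟨fun h m x => h m fun _ => x, fun h m x => h m (x 0)⟩

theorem IsIntAdjoinInv.hasScottSentence {N : ℕ} {G : Type*} [AddCommGroup G]
    (hG : IsIntAdjoinInv N G) : HasComputableDSigma2ScottSentence G := by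
  obtain ⟨σ, hσ, hσ'⟩ := exists_sigma2_sentence N
  obtain ⟨π, hπ, hπg, hπ'⟩ := exists_pi2_sentence N
  refine ⟨σ, π, hσ, hπ, fun A i _ => ⟨fun ⟨h1, h2⟩ => ?_, fun ⟨e⟩ => ?_⟩⟩
  · obtain ⟨g, rfl⟩ := hπg A h2
    rw [hσ'] at h1
    obtain ⟨h2, h3, h4⟩ := (hπ' A).1 h2
    obtain ⟨e⟩ := IsIntAdjoinInv.nonempty_addEquiv ⟨h4, h2, h3, h1⟩ hG
    exact nonempty_equiv_of_addEquiv e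
  · obtain ⟨g, rfl, ⟨e'⟩⟩ := exists_addCommGroup_of_equiv e
    have hA := hG.of_addEquiv e'
    exact ⟨(hσ' A).2 hA.exists_indivisible, (hπ' A).2 ⟨hA.divisible, hA.rank_one, hA.torsion_free⟩⟩

end Scott

/-! ### Diagrams of copies of `ℤ[1/N]` -/

section Numbering

variable {B C : Type*} [AddCommGroup B] [AddCommGroup C] (ι : ℕ → Option B)

theorem codeDiagram_map {B C : Type*} [Zero B] [Neg B] [Add B] [Zero C] [Neg C] [Add C]
    (ι : ℕ → Option B) (f : B → C) (h0 : f 0 = 0) (hn : ∀ x, f (-x) = -f x)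
    (ha : ∀ x y, f (x + y) = f x + f y) (hf : Function.Injective f) :
    codeDiagram (fun a => (ι a).map f) = codeDiagram ι := by
  ext m
  simp only [codeDiagram, Set.mem_ofPred_eq, evalCode_map ι f h0 hn ha, Option.map_eq_some_iff]
  constructor
  · rintro ⟨_, _, ⟨x, hx, rfl⟩, ⟨y, hy, rfl⟩, h⟩
    exact ⟨x, y, hx, hy, by rw [h, hf.eq_iff]⟩
  · rintro ⟨x, y, hx, hy, h⟩
    exact ⟨_, _, ⟨x, hx, rfl⟩, ⟨y, hy, rfl⟩, by rw [h, hf.eq_iff]⟩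

theorem IsNumbering.map {ι : ℕ → Option B} (h : IsNumbering ι) (e : B ≃+ C) :
    IsNumbering fun a => (ι a).map e where
  injective a b x ha hb := by
    obtain ⟨y, hy, rfl⟩ := Option.map_eq_some_iff.1 ha
    obtain ⟨z, hz, hzy⟩ := Option.map_eq_some_iff.1 hb
    exact h.injective a b y hy (by rw [hz, e.injective hzy])
  surjective x := by
    obtain ⟨a, ha⟩ := h.surjective (e.symm x)
    exact ⟨a, by simp [ha]⟩

theorem evalCode_smulCode {t : ℕ} {x : B} (h : evalCode ι t = some x) (k : ℕ) :
    evalCode ι (smulCode k t) = some (k • x) := by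
  induction k with
  | zero => rw [zero_nsmul]; exact evalCode_zero ι
  | succ k ih =>
    change evalCode ι (3 * Nat.pair (smulCode k t) t + 3) = _
    rw [evalCode_add, ih, h, succ_nsmul]
    rfl

/-- The multiple must be positive: `smulCode 0 t` is the code of `0` and has a value even if `t` has
none. -/
theorem evalCode_smulCode_succ (t k : ℕ) :
    evalCode ι (smulCode (k + 1) t) = (evalCode ι t).map fun x => (k + 1) • x := by
  cases h : evalCode ι t with
  | some x => exact evalCode_smulCode ι h _
  | none =>
    change evalCode ι (3 * Nat.pair (smulCode k t) t + 3) = _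
    rw [evalCode_add, h]
    cases evalCode ι (smulCode k t) <;> rfl

end Numbering

/-- The universal-existential conditions on a set `D` of numbers to be the atomic diagram of a
structure isomorphic to `ℤ[1/N]`, where `Y` stands for `D` and `X` for its complement. -/
def DiagramAxioms (N : ℕ) (Y X : ℕ → Prop) (r s t u : ℕ) : Prop :=
  -- `E t t` expresses that `t` denotes an element, that is, that its constants lie in the universe.
  -- Each clause is positive in `Y` and `X`, negation being expressed through `X`; so every clause
  -- is `Σ⁰₁` as soon as `Y` and `X` are c.e.
  let E (s t : ℕ) : Prop := Y (2 * Nat.pair s t)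
  let NE (s t : ℕ) : Prop := X (2 * Nat.pair s t)
  let neg (t : ℕ) : ℕ := 3 * t + 2
  let add (s t : ℕ) : ℕ := 3 * Nat.pair s t + 3
  (Y (2 * Nat.pair s t + 1) ∧ E s s ∧ E t t ∧ NE s t ∨
    X (2 * Nat.pair s t + 1) ∧ (NE s s ∨ NE t t ∨ E s t)) ∧
  (NE s t ∨ E s s ∧ E t s) ∧
  (NE s t ∨ NE t r ∨ E s r) ∧
  E 0 0 ∧
  (E t t ∧ E (neg t) (neg t) ∨ NE t t ∧ NE (neg t) (neg t)) ∧
  (E s s ∧ E t t ∧ E (add s t) (add s t) ∨ (NE s s ∨ NE t t) ∧ NE (add s t) (add s t)) ∧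
  (NE s t ∨ E (neg s) (neg t)) ∧
  (NE s t ∨ NE r u ∨ E (add s r) (add t u)) ∧
  -- This clause and the next make the constants name each element exactly once, as they must when
  -- the universe is a set of numbers.
  (NE t t ∨ ∃ a, E t (3 * a + 1)) ∧
  (NE (3 * s + 1) (3 * t + 1) ∨ s = t) ∧
  (NE r r ∨ NE s s ∨ NE t t ∨ E (add (add r s) t) (add r (add s t))) ∧
  (NE t t ∨ E (add 0 t) t) ∧
  (NE t t ∨ E (add (neg t) t) 0) ∧
  (NE s s ∨ NE t t ∨ E (add s t) (add t s)) ∧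
  (NE t t ∨ NE (smulCode (s + 1) t) 0 ∨ E t 0) ∧
  (NE t t ∨ ∃ a, E a a ∧ E (smulCode N a) t) ∧
  (NE s s ∨ NE t t ∨ ∃ p : ℕ × ℕ, E (smulCode (p.1 + 1) t) (smulCode p.2 s) ∨
    E (smulCode (p.1 + 1) t) (neg (smulCode p.2 s)) ∨ E s 0)

/-- The refutation of the claim that `t` denotes a nonzero element of the structure with
atomic diagram `D` with no divisor `m > 1` prime to `N`. -/
def IndivisibleRefutation (N : ℕ) (Y X : ℕ → Prop) (t : ℕ) : Prop :=
  X (2 * Nat.pair t t) ∨ Y (2 * Nat.pair t 0) ∨ ∃ p : ℕ × ℕ × ℕ × ℕ,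
    (1 < p.1 ∧ p.2.1 * p.1 = p.2.2.1 * N + 1) ∧ Y (2 * Nat.pair (smulCode p.1 p.2.2.2) t)

theorem diagramAxioms_codeDiagram {N : ℕ} {B : Type*} [AddCommGroup B] (hB : IsIntAdjoinInv N B)
    {ι : ℕ → Option B} (hι : IsNumbering ι) (r s t u : ℕ) :
    DiagramAxioms N (· ∈ codeDiagram ι) (· ∉ codeDiagram ι) r s t u := by
  have hT : ∀ t, 2 * Nat.pair t t ∉ codeDiagram ι ∨ ∃ x, evalCode ι t = some x := fun t => by
    rw [even_mem_codeDiagram]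
    cases evalCode ι t <;> simp
  simp only [DiagramAxioms]
  refine ⟨?_, ?_, ?_, ?_, ?_, ?_, ?_, ?_, ?_, ?_, ?_, ?_, ?_, ?_, ?_, ?_, ?_⟩
  · simp only [even_mem_codeDiagram, odd_mem_codeDiagram]
    cases evalCode ι s <;> cases evalCode ι t <;> simp
    grind
  · simp only [even_mem_codeDiagram]
    cases evalCode ι s <;> cases evalCode ι t <;> simp
    grind
  · simp only [even_mem_codeDiagram]
    cases evalCode ι s <;> cases evalCode ι t <;> cases evalCode ι r <;> simp
    grind
  · simp [even_mem_codeDiagram, evalCode_zero]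
  · simp only [even_mem_codeDiagram, evalCode_neg]
    cases evalCode ι t <;> simp
  · simp only [even_mem_codeDiagram, evalCode_add]
    cases evalCode ι s <;> cases evalCode ι t <;> simp
  · simp only [even_mem_codeDiagram, evalCode_neg]
    cases evalCode ι s <;> cases evalCode ι t <;> simp
    grind
  · simp only [even_mem_codeDiagram, evalCode_add]
    cases evalCode ι s <;> cases evalCode ι t <;> cases evalCode ι r <;>
      cases evalCode ι u <;> simp
    grind
  · refine (hT t).imp_right fun ⟨x, hx⟩ => ?_
    obtain ⟨a, ha⟩ := hι.surjective x
    exact ⟨a, (even_mem_codeDiagram ι _ _).2 ⟨x, hx, by rw [evalCode_const, ha]⟩⟩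
  · rw [even_mem_codeDiagram, evalCode_const, evalCode_const, ← imp_iff_not_or]
    rintro ⟨x, hs, ht⟩
    exact hι.injective s t x hs ht
  · refine (hT r).imp_right fun ⟨x, hx⟩ => (hT s).imp_right fun ⟨y, hy⟩ =>
      (hT t).imp_right fun ⟨z, hz⟩ => ?_
    simp [even_mem_codeDiagram, evalCode_add, hx, hy, hz, add_assoc]
  · refine (hT t).imp_right fun ⟨x, hx⟩ => ?_
    simp [even_mem_codeDiagram, evalCode_add, evalCode_zero, hx]
  · refine (hT t).imp_right fun ⟨x, hx⟩ => ?_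
    simp [even_mem_codeDiagram, evalCode_add, evalCode_neg, evalCode_zero, hx]
  · refine (hT s).imp_right fun ⟨x, hx⟩ => (hT t).imp_right fun ⟨y, hy⟩ => ?_
    simp [even_mem_codeDiagram, evalCode_add, hx, hy, add_comm x y]
  · refine (hT t).imp_right fun ⟨x, hx⟩ => ?_
    rw [← imp_iff_not_or]
    simp only [even_mem_codeDiagram, evalCode_smulCode_succ, evalCode_zero, hx]
    simpa using fun h => (hB.torsion_free s x h.symm).symm
  · refine (hT t).imp_right fun ⟨x, hx⟩ => ?_
    obtain ⟨y, hy⟩ := hB.divisible x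
    obtain ⟨a, ha⟩ := hι.surjective y
    rw [← evalCode_const ι] at ha
    refine ⟨3 * a + 1, (even_mem_codeDiagram ι _ _).2 ⟨y, ha, ha⟩,
      (even_mem_codeDiagram ι _ _).2 ⟨x, ?_, hx⟩⟩
    rw [evalCode_smulCode ι ha, hy]
  · refine (hT s).imp_right fun ⟨x, hx⟩ => (hT t).imp_right fun ⟨y, hy⟩ => ?_
    obtain ⟨m, n, hmn⟩ := hB.rank_one x y
    refine ⟨(m, n), ?_⟩
    simp only [even_mem_codeDiagram, evalCode_smulCode ι hx, evalCode_smulCode ι hy, evalCode_neg,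
      evalCode_zero, hx]
    simpa [eq_comm] using hmn

theorem exists_not_indivisibleRefutation {N : ℕ} {B : Type*} [AddCommGroup B]
    (hB : IsIntAdjoinInv N B) {ι : ℕ → Option B} (hι : IsNumbering ι) :
    ∃ t, ¬ IndivisibleRefutation N (· ∈ codeDiagram ι) (· ∉ codeDiagram ι) t := by
  obtain ⟨x, hx, hxd⟩ := hB.exists_indivisible
  obtain ⟨a, ha⟩ := hι.surjective x
  rw [← evalCode_const ι] at ha
  refine ⟨3 * a + 1, ?_⟩
  rintro (h | h | ⟨⟨m, c, d, s⟩, ⟨hm, hcd⟩, h⟩)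
  · exact h ((even_mem_codeDiagram ι _ _).2 ⟨x, ha, ha⟩)
  · obtain ⟨y, hy, hy0⟩ := (even_mem_codeDiagram ι _ _).1 h
    rw [ha, Option.some_inj] at hy
    rw [evalCode_zero, Option.some_inj] at hy0
    exact hx (hy.trans hy0.symm)
  · obtain ⟨y, hy, hy0⟩ := (even_mem_codeDiagram ι _ _).1 h
    rw [ha, Option.some_inj] at hy0
    obtain ⟨k, rfl⟩ : ∃ k, m = k + 1 := ⟨m - 1, by simp only at hm; omega⟩
    simp only [evalCode_smulCode_succ, Option.map_eq_some_iff] at hy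
    obtain ⟨z, -, hz⟩ := hy
    exact hxd _ c d z hm hcd (hz.trans hy0.symm)

-- The term model of a set of codes satisfying the diagram axioms

section Quotient

variable {N : ℕ} {D : Set ℕ}

/-- The codes of closed terms, identified if `D` says that they have the same value. -/
def diagramSetoid (h : ∀ r s t u, DiagramAxioms N (· ∈ D) (· ∉ D) r s t u) :
    Setoid {t : ℕ // 2 * Nat.pair t t ∈ D} where
  r s t := 2 * Nat.pair s t ∈ D
  iseqv :=
    { refl := fun t => t.2
      symm := fun {s t} hst => ((h 0 s t 0).2.1.resolve_left (not_not.2 hst)).2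
      trans := fun {s t r} hst htr =>
        ((h r s t 0).2.2.1.resolve_left (not_not.2 hst)).resolve_left (not_not.2 htr) }

/-- The structure with atomic diagram `D`. -/
def DiagramQuotient (h : ∀ r s t u, DiagramAxioms N (· ∈ D) (· ∉ D) r s t u) : Type :=
  Quotient (diagramSetoid h)

theorem neg_mem_iff (h : ∀ r s t u, DiagramAxioms N (· ∈ D) (· ∉ D) r s t u) (t : ℕ) :
    2 * Nat.pair (3 * t + 2) (3 * t + 2) ∈ D ↔ 2 * Nat.pair t t ∈ D := by
  have := (h 0 0 t 0).2.2.2.2.1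
  tauto

theorem add_mem_iff (h : ∀ r s t u, DiagramAxioms N (· ∈ D) (· ∉ D) r s t u)
    (s t : ℕ) :
    2 * Nat.pair (3 * Nat.pair s t + 3) (3 * Nat.pair s t + 3) ∈ D ↔
      2 * Nat.pair s s ∈ D ∧ 2 * Nat.pair t t ∈ D := by
  have := (h 0 s t 0).2.2.2.2.2.1
  tauto

variable (h : ∀ r s t u, DiagramAxioms N (· ∈ D) (· ∉ D) r s t u)

/-- The value of a term code in the structure with atomic diagram `D`. -/
def DiagramQuotient.mk (t : ℕ) (ht : 2 * Nat.pair t t ∈ D) : DiagramQuotient h :=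
  Quotient.mk (diagramSetoid h) ⟨t, ht⟩

theorem DiagramQuotient.mk_eq_mk {s t : ℕ} (hs : 2 * Nat.pair s s ∈ D)
    (ht : 2 * Nat.pair t t ∈ D) : mk h s hs = mk h t ht ↔ 2 * Nat.pair s t ∈ D :=
  Quotient.eq (r := diagramSetoid h)

theorem DiagramQuotient.ind {p : DiagramQuotient h → Prop}
    (hp : ∀ t ht, p (mk h t ht)) (x : DiagramQuotient h) : p x :=
  Quotient.ind (fun t => hp t.1 t.2) x

instance : Zero (DiagramQuotient h) := ⟨.mk h 0 (h 0 0 0 0).2.2.2.1⟩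

instance : Neg (DiagramQuotient h) :=
  ⟨Quotient.map (fun t => ⟨3 * t.1 + 2, (neg_mem_iff h _).2 t.2⟩) fun s t hst =>
    (h 0 s t 0).2.2.2.2.2.2.1.resolve_left (not_not.2 hst)⟩

instance : Add (DiagramQuotient h) :=
  ⟨Quotient.map₂ (fun s t => ⟨3 * Nat.pair s.1 t.1 + 3, (add_mem_iff h _ _).2 ⟨s.2, t.2⟩⟩)
    fun s t hst r u hru => ((h r s t u).2.2.2.2.2.2.2.1.resolve_left
      (not_not.2 hst)).resolve_left (not_not.2 hru)⟩

namespace DiagramQuotient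

theorem zero_eq : (0 : DiagramQuotient h) = mk h 0 (h 0 0 0 0).2.2.2.1 := rfl

theorem neg_mk {t : ℕ} (ht : 2 * Nat.pair t t ∈ D) :
    -mk h t ht = mk h (3 * t + 2) ((neg_mem_iff h _).2 ht) := rfl

theorem mk_add_mk {s t : ℕ} (hs : 2 * Nat.pair s s ∈ D) (ht : 2 * Nat.pair t t ∈ D) :
    mk h s hs + mk h t ht = mk h (3 * Nat.pair s t + 3) ((add_mem_iff h _ _).2 ⟨hs, ht⟩) := rfl

instance : AddCommGroup (DiagramQuotient h) :=
  { AddGroup.ofLeftAxioms (G := DiagramQuotient h)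
      (ind h fun r hr => ind h fun s hs => ind h fun t ht => by
        simp only [mk_add_mk, mk_eq_mk]
        exact (((h r s t 0).2.2.2.2.2.2.2.2.2.2.1.resolve_left (not_not.2 hr)).resolve_left
          (not_not.2 hs)).resolve_left (not_not.2 ht))
      (ind h fun t ht => by
        rw [zero_eq, mk_add_mk, mk_eq_mk]
        exact (h 0 0 t 0).2.2.2.2.2.2.2.2.2.2.2.1.resolve_left (not_not.2 ht))
      (ind h fun t ht => by
        rw [zero_eq, neg_mk, mk_add_mk, mk_eq_mk]
        exact (h 0 0 t 0).2.2.2.2.2.2.2.2.2.2.2.2.1.resolve_left (not_not.2 ht)) with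
    add_comm := ind h fun s hs => ind h fun t ht => by
      simp only [mk_add_mk, mk_eq_mk]
      exact ((h 0 s t 0).2.2.2.2.2.2.2.2.2.2.2.2.2.1.resolve_left (not_not.2 hs)).resolve_left
        (not_not.2 ht) }

theorem smulCode_mem (h : ∀ r s t u, DiagramAxioms N (· ∈ D) (· ∉ D) r s t u)
    {t : ℕ} (ht : 2 * Nat.pair t t ∈ D) (k : ℕ) :
    2 * Nat.pair (smulCode k t) (smulCode k t) ∈ D := by
  induction k with
  | zero => exact (h 0 0 0 0).2.2.2.1
  | succ k ih => exact (add_mem_iff h (smulCode k t) t).2 ⟨ih, ht⟩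

theorem smul_mk {t : ℕ} (ht : 2 * Nat.pair t t ∈ D) (k : ℕ) :
    k • mk h t ht = mk h (smulCode k t) (smulCode_mem h ht k) := by
  induction k with
  | zero => rw [zero_nsmul]; rfl
  | succ k ih => rw [succ_nsmul, ih]; rfl

theorem isIntAdjoinInv {t₀ : ℕ} (ht₀ : ¬ IndivisibleRefutation N (· ∈ D) (· ∉ D) t₀) :
    IsIntAdjoinInv N (DiagramQuotient h) where
  torsion_free m := ind h fun t ht hm => by
    rw [smul_mk, zero_eq, mk_eq_mk] at hm
    rw [zero_eq, mk_eq_mk]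
    exact ((h 0 m t 0).2.2.2.2.2.2.2.2.2.2.2.2.2.2.1.resolve_left (not_not.2 ht)).resolve_left
      (not_not.2 hm)
  divisible := ind h fun t ht => by
    obtain ⟨a, ha, hat⟩ :=
      (h 0 0 t 0).2.2.2.2.2.2.2.2.2.2.2.2.2.2.2.1.resolve_left (not_not.2 ht)
    exact ⟨mk h a ha, by rw [smul_mk, mk_eq_mk]; exact hat⟩
  rank_one := ind h fun s hs => ind h fun t ht => by
    obtain ⟨⟨m, n⟩, hmn⟩ := ((h 0 s t 0).2.2.2.2.2.2.2.2.2.2.2.2.2.2.2.2.resolve_left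
      (not_not.2 hs)).resolve_left (not_not.2 ht)
    refine ⟨m, n, ?_⟩
    rw [smul_mk, smul_mk, neg_mk, zero_eq, mk_eq_mk, mk_eq_mk, mk_eq_mk]
    exact hmn
  exists_indivisible := by
    simp only [IndivisibleRefutation, not_or, not_not, not_exists, not_and] at ht₀
    obtain ⟨h1, h2, h3⟩ := ht₀
    refine ⟨mk h t₀ h1, ?_, fun m a b y hm hab => ?_⟩
    · rw [zero_eq, ne_eq, mk_eq_mk]
      exact h2
    · induction y using ind with
      | _ s hs =>
        rw [smul_mk, ne_eq, mk_eq_mk]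
        exact h3 (m, a, b, s) ⟨hm, hab⟩

open scoped Classical in
/-- The numbering of the structure with atomic diagram `D` by its constants. -/
noncomputable def numbering (a : ℕ) : Option (DiagramQuotient h) :=
  if ha : 2 * Nat.pair (3 * a + 1) (3 * a + 1) ∈ D then some (mk h (3 * a + 1) ha) else none

-- In a term model the value of a term is its own class; this follows by induction because a term
-- denotes exactly when its subterms do. It is the reason why the diagram of the numbering is `D`
-- again.
open scoped Classical in
theorem evalCode_numbering (m : ℕ) : evalCode (numbering h) m =
    if hm : 2 * Nat.pair m m ∈ D then some (mk h m hm) else none := by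
  induction m using Nat.strong_induction_on with
  | _ m ih =>
    rcases termCode_cases m with rfl | ⟨a, rfl⟩ | ⟨t, ht, rfl⟩ | ⟨s, hs, t, ht, rfl⟩
    · rw [evalCode_zero, dif_pos (h 0 0 0 0).2.2.2.1]; rfl
    · rw [evalCode_const]; rfl
    · rw [evalCode_neg, ih t ht]
      by_cases h1 : 2 * Nat.pair t t ∈ D
      · rw [dif_pos h1, dif_pos ((neg_mem_iff h _).2 h1)]; rfl
      · rw [dif_neg h1, dif_neg (mt (neg_mem_iff h _).1 h1)]; rfl
    · rw [evalCode_add, ih s hs, ih t ht]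
      by_cases h1 : 2 * Nat.pair s s ∈ D ∧ 2 * Nat.pair t t ∈ D
      · rw [dif_pos h1.1, dif_pos h1.2, dif_pos ((add_mem_iff h _ _).2 h1)]; rfl
      · rw [dif_neg (mt (add_mem_iff h _ _).1 h1)]
        rcases not_and_or.1 h1 with h2 | h2
        · rw [dif_neg h2]; rfl
        · rw [dif_neg h2]
          cases (if hs : 2 * Nat.pair s s ∈ D then some (mk h s hs) else none) <;> rfl

theorem evalCode_numbering_eq_some {m : ℕ} {x : DiagramQuotient h} :
    evalCode (numbering h) m = some x ↔ ∃ hm, mk h m hm = x := by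
  rw [evalCode_numbering]
  split_ifs with hm
  · simp [hm]
  · simp [hm]

theorem isNumbering : IsNumbering (numbering h) where
  injective a b x ha hb := by
    rw [← evalCode_const (numbering h), evalCode_numbering_eq_some] at ha hb
    obtain ⟨ha, rfl⟩ := ha
    obtain ⟨hb, hab⟩ := hb
    rw [mk_eq_mk] at hab
    exact ((h 0 b a 0).2.2.2.2.2.2.2.2.2.1.resolve_left (not_not.2 hab)).symm
  surjective := ind h fun t ht => by
    obtain ⟨a, ha⟩ := (h 0 0 t 0).2.2.2.2.2.2.2.2.1.resolve_left (not_not.2 ht)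
    obtain ⟨ha', hat⟩ := (h 0 t (3 * a + 1) 0).2.1.resolve_left (not_not.2 ha)
    have haa := ((h 0 (3 * a + 1) t 0).2.1.resolve_left (not_not.2 hat)).1
    refine ⟨a, ?_⟩
    rw [← evalCode_const (numbering h), evalCode_numbering_eq_some]
    exact ⟨haa, (mk_eq_mk h _ _).2 hat⟩

theorem codeDiagram_numbering : codeDiagram (numbering h) = D := by
  have mem_of : ∀ {s t}, 2 * Nat.pair s t ∈ D → 2 * Nat.pair s s ∈ D ∧ 2 * Nat.pair t t ∈ D := by
    intro s t hst
    obtain ⟨h1, h2⟩ := (h 0 s t 0).2.1.resolve_left (not_not.2 hst)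
    exact ⟨h1, ((h 0 t s 0).2.1.resolve_left (not_not.2 h2)).1⟩
  have heven : ∀ s t, 2 * Nat.pair s t ∈ codeDiagram (numbering h) ↔ 2 * Nat.pair s t ∈ D := by
    intro s t
    simp only [even_mem_codeDiagram, evalCode_numbering_eq_some]
    constructor
    · rintro ⟨x, ⟨hs, rfl⟩, ht, hst⟩
      exact (mk_eq_mk h _ _).1 hst.symm
    · intro hst
      exact ⟨_, ⟨(mem_of hst).1, rfl⟩, (mem_of hst).2, ((mk_eq_mk h _ _).2 hst).symm⟩
  have hodd : ∀ s t, 2 * Nat.pair s t + 1 ∈ codeDiagram (numbering h) ↔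
      2 * Nat.pair s t + 1 ∈ D := by
    intro s t
    have h1 := (h 0 s t 0).1
    simp only [odd_mem_codeDiagram, evalCode_numbering_eq_some]
    constructor
    · rintro ⟨x, y, ⟨hs, rfl⟩, ⟨ht, rfl⟩, hst⟩
      rw [ne_eq, mk_eq_mk] at hst
      tauto
    · intro hst
      have h2 := h1.resolve_right fun h3 => h3.1 hst
      exact ⟨_, _, ⟨h2.2.1, rfl⟩, ⟨h2.2.2.1, rfl⟩, (mk_eq_mk h _ _).not.2 h2.2.2.2⟩
  ext m
  obtain ⟨s, t, rfl | rfl⟩ : ∃ s t, m = 2 * Nat.pair s t ∨ m = 2 * Nat.pair s t + 1 :=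
    ⟨(m / 2).unpair.1, (m / 2).unpair.2, by rw [Nat.pair_unpair]; omega⟩
  · exact heven s t
  · exact hodd s t

end DiagramQuotient

end Quotient

/-- Uniqueness of ℤ[1/N] makes "diagram of a copy of `G`" a condition on `D` alone: the term model
of `D` satisfies the axioms, hence is isomorphic to `G`, and its numbering is transported. -/
theorem exists_numbering_iff {N : ℕ} {G : Type*} [AddCommGroup G] (hG : IsIntAdjoinInv N G)
    (D : Set ℕ) : (∃ ι : ℕ → Option G, IsNumbering ι ∧ codeDiagram ι = D) ↔
      (∀ r s t u, DiagramAxioms N (· ∈ D) (· ∉ D) r s t u) ∧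
        ∃ t, ¬ IndivisibleRefutation N (· ∈ D) (· ∉ D) t := by
  constructor
  · rintro ⟨ι, hι, rfl⟩
    exact ⟨diagramAxioms_codeDiagram hG hι, exists_not_indivisibleRefutation hG hι⟩
  · rintro ⟨h, t, ht⟩
    obtain ⟨e⟩ := (DiagramQuotient.isIntAdjoinInv h ht).nonempty_addEquiv hG
    refine ⟨_, (DiagramQuotient.isNumbering h).map e, ?_⟩
    rw [codeDiagram_map _ e (map_zero e) (map_neg e) (map_add e) e.injective,
      DiagramQuotient.codeDiagram_numbering]

/-! ### The index set is `d`-`Σ⁰₂` -/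

/-- Here `X` is "outputs 0" rather than "does not output 1", so both predicates are c.e. and the
positive matrix stays `Σ⁰₁`. -/
theorem isPi02_diagramAxioms (N : ℕ) : IsPi02 {e | ∀ p : ℕ × ℕ × ℕ × ℕ,
    DiagramAxioms N (1 ∈ phi e ·) (0 ∈ phi e ·) p.1 p.2.1 p.2.2.1 p.2.2.2} := by
  refine IsPi02.of_forall ?_
  simp only [DiagramAxioms]
  repeat' first
    | refine Sigma1.and ?_ ?_
    | refine Sigma1.or ?_ ?_
    | refine Sigma1.mem_phi _ (by fun_prop) (by fun_prop)
    | refine Sigma1.exists_of ?_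
    | exact Sigma1.of_primrecPred (by fun_prop)

theorem isSigma02_exists_not_indivisibleRefutation (N : ℕ) :
    IsSigma02 {e | ∃ t, ¬ IndivisibleRefutation N (1 ∈ phi e ·) (0 ∈ phi e ·) t} := by
  refine isSigma02_of_sigma1
    (P := fun p => IndivisibleRefutation N (1 ∈ phi p.1 ·) (0 ∈ phi p.1 ·) p.2) ?_
  simp only [IndivisibleRefutation]
  repeat' first
    | exact Sigma1.of_primrecPred (by fun_prop)
    | refine Sigma1.and ?_ ?_
    | refine Sigma1.or ?_ ?_
    | refine Sigma1.mem_phi _ (by fun_prop) (by fun_prop)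
    | refine Sigma1.exists_of ?_

theorem isPi02_total : IsPi02 {e | ∀ m : ℕ, 1 ∈ phi e m ∨ 0 ∈ phi e m} :=
  IsPi02.of_forall (.or (.mem_phi _ (by fun_prop) (by fun_prop))
    (.mem_phi _ (by fun_prop) (by fun_prop)))

theorem isCharFun_iff {f : ℕ →. ℕ} {S : Set ℕ} : IsCharFun f S ↔
    (∀ m, 1 ∈ f m ∨ 0 ∈ f m) ∧ S = {m | 1 ∈ f m} := by
  have hex : ∀ m, 1 ∈ f m → 0 ∈ f m → False := fun m h1 h0 =>
    absurd (Part.mem_unique h1 h0) one_ne_zero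
  simp only [IsCharFun, Part.eq_some_iff]
  constructor
  · intro h
    refine ⟨fun m => ?_, Set.ext fun m => ⟨(h m).1, fun h1 => ?_⟩⟩
    · by_cases hm : m ∈ S
      · exact .inl ((h m).1 hm)
      · exact .inr ((h m).2 hm)
    · by_contra hm
      exact hex m h1 ((h m).2 hm)
  · rintro ⟨h, rfl⟩ m
    exact ⟨id, (h m).resolve_left⟩

theorem IsIntAdjoinInv.mem_indexSet_iff {N : ℕ} {G : Type*} [AddCommGroup G]
    (hG : IsIntAdjoinInv N G) (e : ℕ) : e ∈ indexSet G ↔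
      (∀ m, 1 ∈ phi e m ∨ 0 ∈ phi e m) ∧
      (∀ p : ℕ × ℕ × ℕ × ℕ,
        DiagramAxioms N (1 ∈ phi e ·) (0 ∈ phi e ·) p.1 p.2.1 p.2.2.1 p.2.2.2) ∧
      ∃ t, ¬ IndivisibleRefutation N (1 ∈ phi e ·) (0 ∈ phi e ·) t := by
  rw [indexSet, Set.mem_ofPred_eq, exists_structure_iff_exists_numbering]
  simp only [isCharFun_iff]
  -- Only for total `φ_e` with values 0 and 1 is "outputs 0" the complement of "outputs 1".
  have hX : (∀ m, 1 ∈ phi e m ∨ 0 ∈ phi e m) → (0 ∈ phi e ·) = (· ∉ {m | 1 ∈ phi e m}) :=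
    fun h => funext fun m => propext ⟨fun h0 h1 => absurd (Part.mem_unique h1 h0) one_ne_zero,
      fun hm => (h m).resolve_left hm⟩
  have key := exists_numbering_iff hG {m | 1 ∈ phi e m}
  constructor
  · rintro ⟨ι, hι, ht, hD⟩
    obtain ⟨h1, h2⟩ := key.1 ⟨ι, hι, hD⟩
    rw [← hX ht] at h1 h2
    exact ⟨ht, fun p => h1 _ _ _ _, h2⟩
  · rintro ⟨ht, h, h'⟩
    rw [hX ht] at h h'
    obtain ⟨ι, hι, hD⟩ := key.2 ⟨fun r s t u => h (r, s, t, u), h'⟩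
    exact ⟨ι, hι, ht, hD⟩

/-- The indivisible element gives the `Σ⁰₂` set; the set removed is the complement of the `Π⁰₂`
conditions, totality and `DiagramAxioms`. -/
theorem IsIntAdjoinInv.isDSigma02_indexSet {N : ℕ} {G : Type*} [AddCommGroup G]
    (hG : IsIntAdjoinInv N G) : IsDSigma02 (indexSet G) := by
  refine ⟨_, _, isSigma02_exists_not_indivisibleRefutation N,
    (isPi02_total.inter (isPi02_diagramAxioms N)).compl, ?_⟩
  ext e
  rw [hG.mem_indexSet_iff, Set.mem_sdiff, Set.mem_compl_iff, not_not]
  exact ⟨fun ⟨h1, h2, h3⟩ => ⟨h3, h1, h2⟩, fun ⟨h3, h1, h2⟩ => ⟨h1, h2, h3⟩⟩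

/-! ### Primitive recursive evaluation of term codes -/

theorem primrec_evalCode {α B : Type*} [Primcodable α] [Primcodable B] [Zero B] [Neg B] [Add B]
    (hn : Primrec fun x : B => -x) (ha : Primrec₂ fun x y : B => x + y) {ι : α → ℕ → Option B}
    (hι : Primrec₂ ι) : Primrec₂ fun a m => evalCode (ι a) m := by
  have hlen : Primrec fun p : α × List (Option B) => p.2.length - 1 :=
    Primrec.nat_sub.comp (Primrec.list_length.comp .snd) (.const 1)
  have hget : ∀ {f : α × List (Option B) → ℕ}, Primrec f →
      Primrec fun p : α × List (Option B) => p.2.getD (f p) none := fun hf =>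
    (Primrec.list_getD none).comp .snd hf
  -- Course-of-values recursion: `l` lists the values at all smaller codes, so its length is the
  -- code being evaluated and `l.length - 1` is the `m` of the clause `m + 1` in `evalCode`.
  refine Primrec.nat_strong_rec _ (g := fun a l => some
    (if l.length = 0 then some 0
      else if (l.length - 1) % 3 = 0 then ι a ((l.length - 1) / 3)
      else if (l.length - 1) % 3 = 1 then (l.getD ((l.length - 1) / 3) none).map (- ·)
      else (l.getD ((l.length - 1) / 3).unpair.1 none).bind fun x =>
        (l.getD ((l.length - 1) / 3).unpair.2 none).map fun y => x + y)) ?_ ?_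
  · refine Primrec.option_some.comp ?_
    refine Primrec.ite (Primrec.eq.comp (Primrec.list_length.comp .snd) (.const 0))
      (.const _) ?_
    refine Primrec.ite (by fun_prop) (hι.comp .fst (by fun_prop)) ?_
    refine Primrec.ite (by fun_prop)
      (Primrec.option_map (hget (by fun_prop)) (hn.comp .snd)) ?_
    have h1 : Primrec fun p : α × List (Option B) =>
        p.2.getD ((p.2.length - 1) / 3).unpair.1 none := hget (by fun_prop)
    have h2 : Primrec fun p : α × List (Option B) =>
        p.2.getD ((p.2.length - 1) / 3).unpair.2 none := hget (by fun_prop)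
    exact Primrec.option_bind h1
      (Primrec.option_map (h2.comp .fst) (ha.comp (Primrec.snd.comp .fst) .snd))
  · intro a n
    rcases n with _ | n
    · simp [evalCode_zero]
    · have hg : ∀ i ≤ n, ((List.range (n + 1)).map (evalCode (ι a))).getD i none =
          evalCode (ι a) i := fun i hi => by
        simp [List.getD_eq_getElem?_getD, List.getElem?_range (Nat.lt_succ_of_le hi)]
      have h3 := Nat.div_le_self n 3
      simp only [List.length_map, List.length_range, Nat.add_sub_cancel, Nat.succ_ne_zero,
        if_false, hg _ h3, hg _ ((Nat.unpair_left_le _).trans h3),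
        hg _ ((Nat.unpair_right_le _).trans h3)]
      rw [evalCode]

/-! ### Fractions -/

/-- The triple `(x, y, d)` stands for the fraction `(x - y) / (d + 1)`. -/
def Frac : Type := ℕ × ℕ × ℕ

namespace Frac

instance : Primcodable Frac := inferInstanceAs (Primcodable (ℕ × ℕ × ℕ))

/-- The fraction `(x - y) / (d + 1)`. -/
def mk (x y d : ℕ) : Frac := (x, y, d)

/-- The positive part of the numerator. -/
def pos (p : Frac) : ℕ := Prod.fst p

/-- The negative part of the numerator. -/
def neg (p : Frac) : ℕ := (Prod.snd p).1

/-- The denominator. -/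
def den (p : Frac) : ℕ := (Prod.snd p).2 + 1

@[fun_prop] theorem primrec_mk {α : Type*} [Primcodable α] {f g h : α → ℕ} (hf : Primrec f)
    (hg : Primrec g) (hh : Primrec h) : Primrec fun x => mk (f x) (g x) (h x) :=
  hf.pair (hg.pair hh)

@[fun_prop] theorem primrec_pos {α : Type*} [Primcodable α] {f : α → Frac} (hf : Primrec f) :
    Primrec fun x => (f x).pos := Primrec.fst.comp hf

@[fun_prop] theorem primrec_neg {α : Type*} [Primcodable α] {f : α → Frac} (hf : Primrec f) :
    Primrec fun x => (f x).neg := Primrec.fst.comp (Primrec.snd.comp hf)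

@[fun_prop] theorem primrec_den {α : Type*} [Primcodable α] {f : α → Frac} (hf : Primrec f) :
    Primrec fun x => (f x).den := Primrec.succ.comp (Primrec.snd.comp (Primrec.snd.comp hf))

instance : Zero Frac := ⟨mk 0 0 0⟩

instance : Neg Frac := ⟨fun p => mk p.neg p.pos (p.den - 1)⟩

instance : Add Frac := ⟨fun p q => mk (p.pos * q.den + q.pos * p.den)
  (p.neg * q.den + q.neg * p.den) (p.den * q.den - 1)⟩

/-- The rational number that is the value of a fraction. -/
def toRat (p : Frac) : ℚ := (p.pos - p.neg) / p.den

theorem den_ne_zero (p : Frac) : (p.den : ℚ) ≠ 0 := by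
  rw [den]
  positivity

theorem toRat_zero : toRat 0 = 0 := by
  change ((0 : ℕ) - (0 : ℕ) : ℚ) / _ = 0
  simp

theorem toRat_neg (p : Frac) : toRat (-p) = -toRat p := by
  change ((p.neg : ℚ) - p.pos) / _ = -((p.pos - p.neg) / p.den)
  rw [← neg_div, neg_sub]
  rfl

theorem toRat_add (p q : Frac) : toRat (p + q) = toRat p + toRat q := by
  have h : ((p + q).den : ℚ) = p.den * q.den := by
    have : (p + q).den = p.den * q.den :=
      Nat.sub_add_cancel (Nat.mul_pos (Nat.succ_pos _) (Nat.succ_pos _))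
    rw [this, Nat.cast_mul]
  have hp := p.den_ne_zero
  have hq := q.den_ne_zero
  rw [toRat, h]
  change (((p.pos * q.den + q.pos * p.den : ℕ) : ℚ) - (p.neg * q.den + q.neg * p.den : ℕ)) / _ = _
  rw [toRat, toRat]
  push_cast
  field_simp
  ring

theorem toRat_eq_toRat {p q : Frac} : toRat p = toRat q ↔
    p.pos * q.den + q.neg * p.den = q.pos * p.den + p.neg * q.den := by
  rw [toRat, toRat, div_eq_div_iff p.den_ne_zero q.den_ne_zero, ← Nat.cast_inj (R := ℚ)]
  push_cast
  constructor <;> intro h <;> linarith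

end Frac

/-! ### A uniformly computable family of groups -/

section Family

variable (R : ℕ × ℕ × ℕ → Prop) [DecidablePred R]

/-- The search for some `x` such that `R (n, x, y)` for all `y`: after `s` steps, the pair of the
candidate `x` and the next `y` to be checked. -/
def search (n s : ℕ) : ℕ × ℕ :=
  s.rec (0, 0) fun _ p => if R (n, p.1, p.2) then (p.1, p.2 + 1) else (p.1 + 1, 0)

theorem search_succ (n s : ℕ) : search R n (s + 1) =
    if R (n, (search R n s).1, (search R n s).2) then
      ((search R n s).1, (search R n s).2 + 1) else ((search R n s).1 + 1, 0) := rfl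

theorem primrec_search (hR : PrimrecPred R) : Primrec₂ (search R) :=
  Primrec.nat_rec (f := fun _ : ℕ => (0, 0))
    (g := fun n p => if R (n, p.2.1, p.2.2) then (p.2.1, p.2.2 + 1) else (p.2.1 + 1, 0))
    (by fun_prop) (by unfold Primrec₂; fun_prop)

theorem search_monotone (n : ℕ) : Monotone fun s => (search R n s).1 := by
  refine monotone_nat_of_le_succ fun s => ?_
  rw [search_succ]
  split_ifs
  · exact le_rfl
  · exact Nat.le_succ _

/-- A candidate is abandoned only when refuted, so the search never passes a correct one. -/
theorem search_le {n x : ℕ} (hx : ∀ y, R (n, x, y)) (s : ℕ) : (search R n s).1 ≤ x := by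
  induction s with
  | zero => exact Nat.zero_le _
  | succ s ih =>
    rw [search_succ]
    split_ifs with h
    · exact ih
    · refine Nat.succ_le_of_lt (lt_of_le_of_ne ih fun he => h ?_)
      rw [he]
      exact hx _

theorem of_lt_search {n s y : ℕ} (hy : y < (search R n s).2) : R (n, (search R n s).1, y) := by
  induction s with
  | zero => exact absurd hy (Nat.not_lt_zero y)
  | succ s ih =>
    rw [search_succ] at hy ⊢
    split_ifs at hy ⊢ with h
    · rcases Nat.lt_succ_iff_lt_or_eq.1 hy with h1 | rfl
      · exact ih h1
      · exact h
    · exact absurd hy (Nat.not_lt_zero y)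

/-- If the candidate never changed after step `s`, the second component would grow without bound and
every instance would be verified, making the candidate a witness. -/
theorem exists_lt_search {n : ℕ} (h : ¬ ∃ x, ∀ y, R (n, x, y)) (s : ℕ) :
    ∃ t, (search R n s).1 < (search R n t).1 := by
  by_contra! hc
  have hc' : ∀ k, (search R n (s + k)).1 = (search R n s).1 := fun k =>
    le_antisymm (hc _) (search_monotone R n (Nat.le_add_right s k))
  have hR : ∀ k, R (n, (search R n s).1, (search R n (s + k)).2) := fun k => by
    by_contra hk
    have := hc' (k + 1)
    rw [← add_assoc, search_succ, hc' k, if_neg hk] at this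
    simp at this
  have hk : ∀ k, (search R n (s + k)).2 = (search R n s).2 + k := fun k => by
    induction k with
    | zero => rfl
    | succ k ih =>
      rw [← add_assoc, search_succ, hc' k, if_pos (hR k)]
      change (search R n (s + k)).2 + 1 = _
      omega
  refine h ⟨(search R n s).1, fun y => ?_⟩
  rw [← hc' (y + 1)]
  exact of_lt_search R (by rw [hk]; omega)

/-- The common denominator of the fractions available at step `s`. -/
def stageDen (N n s : ℕ) : ℕ := N ^ s * (N + 1) ^ (search R n s).1

theorem primrec_pow_const {α : Type*} [Primcodable α] (b : ℕ) {f : α → ℕ} (hf : Primrec f) :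
    Primrec fun x => b ^ f x := by
  have : Primrec fun k => b ^ k :=
    (Primrec.nat_rec₁ (f := fun _ p => p * b) 1 (by unfold Primrec₂; fun_prop)).of_eq fun k => by
      induction k with
      | zero => rfl
      | succ k ih => rw [pow_succ, ← ih]
  exact this.comp hf

theorem primrec_stageDen (hR : PrimrecPred R) (N : ℕ) : Primrec₂ (stageDen R N) := by
  have := primrec_search R hR
  exact Primrec.nat_mul.comp (primrec_pow_const N .snd)
    (primrec_pow_const (N + 1) (Primrec.fst.comp this))

variable {N : ℕ} (n : ℕ)

theorem stageDen_pos (hN : 0 < N) (s : ℕ) : 0 < stageDen R N n s :=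
  Nat.mul_pos (pow_pos hN _) (pow_pos N.succ_pos _)

theorem stageDen_dvd {s t : ℕ} (h : s ≤ t) : stageDen R N n s ∣ stageDen R N n t :=
  mul_dvd_mul (pow_dvd_pow _ h) (pow_dvd_pow _ (search_monotone R n h))

/-- The group of all rational numbers with some `stageDen` as a denominator. -/
def stageGroup (N n : ℕ) : AddSubgroup ℚ where
  carrier := {r | ∃ (s : ℕ) (a : ℤ), r * stageDen R N n s = a}
  zero_mem' := ⟨0, 0, by simp⟩
  add_mem' := by
    rintro r r' ⟨s, a, h⟩ ⟨s', a', h'⟩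
    obtain ⟨c, hc⟩ := stageDen_dvd R (N := N) n (le_max_left s s')
    obtain ⟨c', hc'⟩ := stageDen_dvd R (N := N) n (le_max_right s s')
    refine ⟨max s s', a * c + a' * c', ?_⟩
    rw [add_mul]
    nth_rewrite 1 [hc]
    rw [hc']
    push_cast
    rw [← h, ← h']
    ring
  neg_mem' := by
    rintro r ⟨s, a, h⟩
    exact ⟨s, -a, by rw [neg_mul, h]; push_cast; rfl⟩

theorem smul_surjective_of_stageDen_dvd {m : ℕ} (hm : 0 < m)
    (h : ∀ s, ∃ t, m * stageDen R N n s ∣ stageDen R N n t) (x : stageGroup R N n) :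
    ∃ y, m • y = x := by
  obtain ⟨r, s, a, hr⟩ := x
  obtain ⟨t, c, hc⟩ := h s
  have hm' : (m : ℚ) ≠ 0 := by exact_mod_cast hm.ne'
  refine ⟨⟨r / m, t, a * c, ?_⟩, Subtype.ext ?_⟩
  · rw [hc]
    push_cast
    rw [← hr]
    field_simp
  · rw [AddSubgroup.coe_nsmul, nsmul_eq_mul]
    exact mul_div_cancel₀ r hm'

theorem smul_surjective_stageGroup (h : ¬ ∃ x, ∀ y, R (n, x, y)) (x : stageGroup R N n) :
    ∃ y, (N + 1) • y = x := by
  refine smul_surjective_of_stageDen_dvd R n N.succ_pos (fun s => ?_) x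
  obtain ⟨t, ht⟩ := exists_lt_search R h s
  have hst : s ≤ t := by
    by_contra! hts
    exact absurd (search_monotone R n hts.le) (not_le.2 ht)
  refine ⟨t, ?_⟩
  rw [stageDen, mul_left_comm, ← pow_succ']
  exact mul_dvd_mul (pow_dvd_pow _ hst) (pow_dvd_pow _ ht)

/-- Once the search has settled on a candidate `c`, the group is `(N + 1) ^ (-c)` times ℤ[1/N], and
`1 / (N + 1) ^ c` is indivisible. -/
theorem isIntAdjoinInv_stageGroup (hN : 0 < N) {x : ℕ} (hx : ∀ y, R (n, x, y)) :
    IsIntAdjoinInv N (stageGroup R N n) where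
  torsion_free m r hr := by
    have h := congrArg Subtype.val hr
    rw [AddSubgroup.coe_nsmul, nsmul_eq_mul, AddSubgroup.coe_zero, mul_eq_zero] at h
    exact Subtype.ext (h.resolve_left (by positivity))
  divisible := smul_surjective_of_stageDen_dvd R n hN fun s => ⟨s + 1, by
    rw [stageDen, ← mul_assoc, ← pow_succ']
    exact mul_dvd_mul_left _ (pow_dvd_pow _ (search_monotone R n s.le_succ))⟩
  rank_one r y := by
    by_cases hr : r = 0
    · exact ⟨0, 0, .inr (.inr hr)⟩
    obtain ⟨m, a, hma⟩ := exists_commensurable r y hr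
    rw [natCast_zsmul] at hma
    refine ⟨m, a.natAbs, ?_⟩
    rcases Int.natAbs_eq a with h | h
    · left; rw [hma, ← natCast_zsmul, ← h]
    · right; left; rw [hma, ← natCast_zsmul, ← neg_smul, ← h]
  exists_indivisible := by
    obtain ⟨s₀, hs₀⟩ : ∃ s₀, ∀ s, s₀ ≤ s → (search R n s).1 = (search R n s₀).1 := by
      obtain ⟨_, ⟨s₀, rfl⟩, hs₀⟩ := Set.exists_max_image (Set.range fun s => (search R n s).1) id
        ((Set.finite_Iic x).subset (Set.range_subset_iff.2 fun s => search_le R hx s))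
        (Set.range_nonempty _)
      exact ⟨s₀, fun s hs => le_antisymm (hs₀ _ ⟨s, rfl⟩) (search_monotone R n hs)⟩
    have hN1 : ((N + 1 : ℕ) : ℚ) ^ (search R n s₀).1 ≠ 0 := by positivity
    refine ⟨⟨1 / ((N + 1 : ℕ) : ℚ) ^ (search R n s₀).1, s₀, (N : ℤ) ^ s₀, ?_⟩, ?_, ?_⟩
    · rw [stageDen]
      push_cast at hN1 ⊢
      field_simp
    · intro h
      have := congrArg Subtype.val h
      simp only [AddSubgroup.coe_zero] at this
      exact one_div_ne_zero hN1 this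
    · rintro m a b ⟨r, s, c, hr⟩ hm hab hy
      have hy' := congrArg Subtype.val hy
      rw [AddSubgroup.coe_nsmul, nsmul_eq_mul, eq_div_iff hN1] at hy'
      simp only at hy'
      obtain ⟨d, hd⟩ := stageDen_dvd R (N := N) n (le_max_left s s₀)
      -- Clearing denominators in the division by `m` makes `m` a divisor of a power of `N`; being
      -- prime to `N`, it is a unit.
      have h1 : (m : ℤ) * (c * d) = (N : ℤ) ^ max s s₀ := by
        have h2 : (m : ℚ) * (r * stageDen R N n (max s s₀)) = (N : ℚ) ^ max s s₀ := by
          rw [stageDen, hs₀ _ (le_max_right s s₀)]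
          push_cast at hy' ⊢
          linear_combination (N : ℚ) ^ max s s₀ * hy'
        rw [hd] at h2
        push_cast at h2
        rw [← mul_assoc r, hr] at h2
        exact_mod_cast h2
      have hcop : IsCoprime (m : ℤ) ((N : ℤ) ^ max s s₀) := by
        refine IsCoprime.pow_right ⟨a, -b, ?_⟩
        have : (a * m : ℤ) = b * N + 1 := by exact_mod_cast hab
        linarith
      have hu := hcop.isUnit_of_dvd' dvd_rfl ⟨_, h1.symm⟩
      rw [Int.isUnit_iff] at hu
      omega

/-- The fraction numbered by `c`. -/
def stageFrac (N n c : ℕ) : Frac :=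
  .mk c.unpair.1 c.unpair.2.unpair.1 (stageDen R N n c.unpair.2.unpair.2 - 1)

theorem toRat_stageFrac (hN : 0 < N) (c : ℕ) : (stageFrac R N n c).toRat =
    ((c.unpair.1 : ℚ) - c.unpair.2.unpair.1) / stageDen R N n c.unpair.2.unpair.2 := by
  have : (stageFrac R N n c).den = stageDen R N n c.unpair.2.unpair.2 :=
    Nat.sub_add_cancel (stageDen_pos R n hN _)
  rw [Frac.toRat, this]
  rfl

theorem toRat_stageFrac_mem (hN : 0 < N) (c : ℕ) :
    (stageFrac R N n c).toRat ∈ stageGroup R N n := by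
  have h : (stageDen R N n c.unpair.2.unpair.2 : ℚ) ≠ 0 := by
    exact_mod_cast (stageDen_pos R n hN _).ne'
  refine ⟨c.unpair.2.unpair.2, (c.unpair.1 : ℤ) - c.unpair.2.unpair.1, ?_⟩
  rw [toRat_stageFrac R n hN, div_mul_cancel₀ _ h]
  push_cast
  rfl

theorem exists_toRat_stageFrac_eq (hN : 0 < N) {r : ℚ} (hr : r ∈ stageGroup R N n) :
    ∃ c, (stageFrac R N n c).toRat = r := by
  obtain ⟨s, a, h⟩ := hr
  have hs : (stageDen R N n s : ℚ) ≠ 0 := by exact_mod_cast (stageDen_pos R n hN _).ne'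
  refine ⟨Nat.pair a.toNat (Nat.pair (-a).toNat s), ?_⟩
  rw [toRat_stageFrac R n hN]
  simp only [Nat.unpair_pair]
  rw [div_eq_iff hs, h]
  have : (a.toNat : ℤ) - (-a).toNat = a := by omega
  exact_mod_cast this

/-- Fractions with the same value. -/
def Frac.Equiv (p q : Frac) : Prop :=
  p.pos * q.den + q.neg * p.den = q.pos * p.den + p.neg * q.den

instance (p q : Frac) : Decidable (p.Equiv q) := inferInstanceAs (Decidable (_ = _))

theorem Frac.primrecPred_equiv {α : Type*} [Primcodable α] {f g : α → Frac} (hf : Primrec f)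
    (hg : Primrec g) : PrimrecPred fun x => (f x).Equiv (g x) := by
  unfold Frac.Equiv
  fun_prop

/-- The fraction numbered by `c`, unless an equal one has a smaller number. -/
def stageNumbering (N n c : ℕ) : Option Frac :=
  if ∀ b < c, ¬ (stageFrac R N n b).Equiv (stageFrac R N n c) then some (stageFrac R N n c)
  else none

theorem primrec_stageFrac (hR : PrimrecPred R) (N : ℕ) : Primrec₂ (stageFrac R N) := by
  have h : Primrec fun p : ℕ × ℕ => stageDen R N p.1 p.2.unpair.2.unpair.2 - 1 :=
    Primrec.nat_sub.comp ((primrec_stageDen R hR N).comp .fst (by fun_prop)) (.const 1)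
  exact Frac.primrec_mk (by fun_prop) (by fun_prop) h

theorem primrec_stageNumbering (hR : PrimrecPred R) (N : ℕ) : Primrec₂ (stageNumbering R N) := by
  have h := primrec_stageFrac R hR N
  unfold stageNumbering
  generalize stageFrac R N = f at h
  have h1 : PrimrecRel fun (b : ℕ) (p : ℕ × ℕ) => ¬ (f p.1 b).Equiv (f p.1 p.2) := by
    have h2 : Primrec fun q : ℕ × ℕ × ℕ => f q.2.1 q.1 := h.comp (by fun_prop) (by fun_prop)
    have h3 : Primrec fun q : ℕ × ℕ × ℕ => f q.2.1 q.2.2 := h.comp (by fun_prop) (by fun_prop)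
    exact (Frac.primrecPred_equiv h2 h3).not
  have h4 : PrimrecPred fun p : ℕ × ℕ => ∀ b < p.2, ¬ (f p.1 b).Equiv (f p.1 p.2) :=
    (PrimrecPred.comp (f := fun p : ℕ × ℕ => (List.range p.2, p)) h1.forall_mem_list
      ((Primrec.list_range.comp .snd).pair .id)).of_eq (by simp)
  exact Primrec.ite h4 (Primrec.option_some.comp h) (.const _)

/-- The numbering of `stageGroup` given by `stageNumbering`. -/
def stageGroupNumbering (hN : 0 < N) (c : ℕ) : Option (stageGroup R N n) :=
  (stageNumbering R N n c).pmap (fun p hp => ⟨p.toRat, hp⟩) fun p hp => by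
    rw [stageNumbering] at hp
    split_ifs at hp
    obtain rfl := Option.some_inj.1 hp
    exact toRat_stageFrac_mem R n hN c

theorem map_stageGroupNumbering (hN : 0 < N) (c : ℕ) :
    (stageGroupNumbering R n hN c).map Subtype.val = (stageNumbering R N n c).map Frac.toRat := by
  rw [stageGroupNumbering, Option.map_pmap]
  exact Option.pmap_eq_map _ _ _ _

theorem isNumbering_stageGroupNumbering (hN : 0 < N) :
    IsNumbering (stageGroupNumbering R n hN) := by
  have key : ∀ (c : ℕ) (x : stageGroup R N n), stageGroupNumbering R n hN c = some x ↔
      (∀ b < c, (stageFrac R N n b).toRat ≠ (stageFrac R N n c).toRat) ∧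
        (stageFrac R N n c).toRat = x := by
    intro c x
    have h1 : stageGroupNumbering R n hN c = some x ↔
        (stageNumbering R N n c).map Frac.toRat = some (x : ℚ) := by
      rw [← map_stageGroupNumbering R n hN, Option.map_eq_some_iff]
      exact ⟨fun h => ⟨x, h, rfl⟩, fun ⟨y, hy, hyx⟩ => Subtype.ext hyx ▸ hy⟩
    rw [h1, stageNumbering]
    simp only [ne_eq, Frac.toRat_eq_toRat]
    change _ ↔ (∀ b < c, ¬ (stageFrac R N n b).Equiv _) ∧ _
    split_ifs with h
    · rw [and_iff_right h, Option.map_some, Option.some_inj]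
    · simp [h]
  constructor
  · intro a b x ha hb
    obtain ⟨ha, ha'⟩ := (key a x).1 ha
    obtain ⟨hb, hb'⟩ := (key b x).1 hb
    rcases lt_trichotomy a b with h | h | h
    · exact absurd (ha'.trans hb'.symm) (hb a h)
    · exact h
    · exact absurd (hb'.trans ha'.symm) (ha b h)
  · intro x
    have hex := exists_toRat_stageFrac_eq R n hN x.2
    refine ⟨Nat.find hex, (key _ x).2 ⟨fun b hb h => Nat.find_min hex hb ?_, Nat.find_spec hex⟩⟩
    rw [h]
    exact Nat.find_spec hex

/-- The atomic diagram of `stageGroup`. -/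
def stageDiagram (N n : ℕ) : Set ℕ :=
  {m | ∃ p q, evalCode (stageNumbering R N n) (m / 2).unpair.1 = some p ∧
    evalCode (stageNumbering R N n) (m / 2).unpair.2 = some q ∧ (m % 2 = 0 ↔ p.Equiv q)}

/-- Replaces arithmetic in a subgroup of ℚ that varies with `n` by arithmetic on triples of natural
numbers, which is primitive recursive uniformly in `n`. -/
theorem codeDiagram_stageGroupNumbering (hN : 0 < N) :
    codeDiagram (stageGroupNumbering R n hN) = stageDiagram R N n := by
  rw [← codeDiagram_map (stageGroupNumbering R n hN) Subtype.val rfl (fun _ => rfl)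
    (fun _ _ => rfl) Subtype.val_injective]
  simp only [map_stageGroupNumbering]
  ext m
  simp only [codeDiagram, stageDiagram, Set.mem_ofPred_eq,
    evalCode_map _ Frac.toRat Frac.toRat_zero Frac.toRat_neg Frac.toRat_add,
    Option.map_eq_some_iff]
  constructor
  · rintro ⟨_, _, ⟨p, hp, rfl⟩, ⟨q, hq, rfl⟩, h⟩
    exact ⟨p, q, hp, hq, h.trans Frac.toRat_eq_toRat⟩
  · rintro ⟨p, q, hp, hq, h⟩
    exact ⟨_, _, ⟨p, hp, rfl⟩, ⟨q, hq, rfl⟩, h.trans Frac.toRat_eq_toRat.symm⟩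

theorem primrecPred_exists_some {α B : Type*} [Primcodable α] [Primcodable B] {f g : α → Option B}
    {p : α → B → B → Prop} (hf : Primrec f) (hg : Primrec g)
    (hp : PrimrecPred fun a : (α × B) × B => p a.1.1 a.1.2 a.2) :
    PrimrecPred fun a => ∃ x y, f a = some x ∧ g a = some y ∧ p a x y := by
  obtain ⟨_, hp⟩ := hp
  have h : Primrec fun a => (f a).bind fun x => (g a).map fun y => decide (p ((a, x), y).1.1 x y) :=
    Primrec.option_bind hf (Primrec.option_map (hg.comp .fst) hp.to₂).to₂
  refine (primrecPred_eq h (primrec_const (some true))).of_eq fun a => ?_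
  simp only [Option.bind_eq_some_iff, Option.map_eq_some_iff, decide_eq_true_eq]
  exact ⟨fun ⟨x, hx, y, hy, h⟩ => ⟨x, y, hx, hy, h⟩, fun ⟨x, y, hx, hy, h⟩ => ⟨x, hx, y, hy, h⟩⟩

theorem primrecPred_stageDiagram (hR : PrimrecPred R) (N : ℕ) :
    PrimrecPred fun p : ℕ × ℕ => p.2 ∈ stageDiagram R N p.1 := by
  have hneg : Primrec fun p : Frac => -p :=
    Frac.primrec_mk (by fun_prop) (by fun_prop) (Primrec.nat_sub.comp (by fun_prop) (.const 1))
  have hadd : Primrec₂ fun p q : Frac => p + q :=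
    Frac.primrec_mk (by fun_prop) (by fun_prop) (Primrec.nat_sub.comp (by fun_prop) (.const 1))
  have hev := primrec_evalCode hneg hadd (primrec_stageNumbering R hR N)
  have h1 : Primrec fun p : ℕ × ℕ => evalCode (stageNumbering R N p.1) (p.2 / 2).unpair.1 :=
    hev.comp .fst (by fun_prop)
  have h2 : Primrec fun p : ℕ × ℕ => evalCode (stageNumbering R N p.1) (p.2 / 2).unpair.2 :=
    hev.comp .fst (by fun_prop)
  refine primrecPred_exists_some h1 h2
    (p := fun a x y => a.2 % 2 = 0 ↔ x.Equiv y) ?_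
  have h4 : PrimrecPred fun a : ((ℕ × ℕ) × Frac) × Frac => a.1.2.Equiv a.2 :=
    Frac.primrecPred_equiv (by fun_prop) (by fun_prop)
  have h5 : PrimrecPred fun a : ((ℕ × ℕ) × Frac) × Frac => a.1.1.2 % 2 = 0 := by fun_prop
  exact ((h5.and h4).or (h5.not.and h4.not)).of_eq fun a => by tauto

/-- By `exists_numbering_iff` no isomorphism has to be discussed: if the search never settles,
divisibility by `N + 1` refutes the indivisibility of every element. -/
theorem exists_numbering_stageDiagram_iff (hN : 0 < N) {G : Type*} [AddCommGroup G]
    (hG : IsIntAdjoinInv N G) :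
    (∃ ι : ℕ → Option G, IsNumbering ι ∧ codeDiagram ι = stageDiagram R N n) ↔
      ∃ x, ∀ y, R (n, x, y) := by
  rw [exists_numbering_iff hG, ← codeDiagram_stageGroupNumbering R n hN]
  have hι := isNumbering_stageGroupNumbering R n hN
  set ι := stageGroupNumbering R n hN
  constructor
  · rintro ⟨-, t, ht⟩
    by_contra h
    simp only [IndivisibleRefutation, not_or, not_not] at ht
    obtain ⟨h1, -, h3⟩ := ht
    obtain ⟨z, hz, -⟩ := (even_mem_codeDiagram _ _ _).1 h1
    obtain ⟨w, hw⟩ := smul_surjective_stageGroup R n h z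
    obtain ⟨b, hb⟩ := hι.surjective w
    rw [← evalCode_const ι] at hb
    -- The equation `1 * (N + 1) = 1 * N + 1` certifies that `N + 1` is prime to `N`, and `0 < N`
    -- gives `1 < N + 1`.
    refine h3 ⟨(N + 1, 1, 1, 3 * b + 1), ⟨by simp only; omega, by simp only; omega⟩, ?_⟩
    exact (even_mem_codeDiagram _ _ _).2 ⟨z, by rw [evalCode_smulCode ι hb, hw], hz⟩
  · rintro ⟨x, hx⟩
    have hA := isIntAdjoinInv_stageGroup R n hN hx
    exact ⟨diagramAxioms_codeDiagram hA hι, exists_not_indivisibleRefutation hA hι⟩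

end Family

/-! ### Completeness -/

theorem IsIntAdjoinInv.isMCompleteDSigma02_indexSet {N : ℕ} (hN : 0 < N) {G : Type*}
    [AddCommGroup G] (hG : IsIntAdjoinInv N G) : IsMCompleteDSigma02 (indexSet G) := by
  classical
  refine ⟨hG.isDSigma02_indexSet, ?_⟩
  rintro _ ⟨S₁, S₂, hS₁, hS₂, rfl⟩
  obtain ⟨R₁, hR₁, h₁⟩ := hS₁.exists_primrecPred
  obtain ⟨R₂, hR₂, h₂⟩ := hS₂.exists_primrecPred
  -- The computation at `m` waits for a `y` refuting `m` as a witness of `n ∈ S₂`, discards that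
  -- `y`, and answers the diagram question. One undefined value is enough to keep the index out of
  -- the index set.
  set F : ℕ → ℕ →. ℕ := fun n m =>
    (Nat.rfind fun y => Part.some (decide (¬ R₂ (n, m, y)))).map fun _ =>
      if m ∈ stageDiagram R₁ N n then 1 else 0 with hF
  have hFp : Partrec₂ F := by
    have h1 : Partrec fun p : ℕ × ℕ =>
        Nat.rfind fun y => Part.some (decide (¬ R₂ (p.1, p.2, y))) :=
      Partrec.rfind (Primrec.to_comp (f := fun q : (ℕ × ℕ) × ℕ =>
        decide (¬ R₂ (q.1.1, q.1.2, q.2))) (by fun_prop)).partrec.to₂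
    have h2 := primrecPred_stageDiagram R₁ hR₁ N
    have h3 : Primrec fun q : (ℕ × ℕ) × ℕ => if q.1.2 ∈ stageDiagram R₁ N q.1.1 then 1 else 0 :=
      Primrec.ite (h2.comp .fst) (.const 1) (.const 0)
    exact h1.map h3.to_comp.to₂
  obtain ⟨c, hc⟩ := Nat.Partrec.Code.exists_code.1 (Partrec₂.unpaired'.2 hFp)
  have hphi : ∀ n, phi (Encodable.encode (c.curry n)) = F n := fun n => by
    funext m
    rw [phi, Denumerable.ofNat_encode, Nat.Partrec.Code.eval_curry, hc]
    simp [Nat.unpaired]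
  refine ⟨fun n => Encodable.encode (c.curry n), (Primrec.encode.comp
    (Nat.Partrec.Code.primrec₂_curry.comp (.const c) .id)).to_comp, fun n => ?_⟩
  change n ∈ S₁ \ S₂ ↔ _ ∈ indexSet G
  rw [indexSet, Set.mem_ofPred_eq, exists_structure_iff_exists_numbering, hphi n]
  have hmem : ∀ m v, v ∈ F n m ↔ (∃ y, ¬ R₂ (n, m, y)) ∧
      v = if m ∈ stageDiagram R₁ N n then 1 else 0 := by
    intro m v
    simp only [hF, Part.mem_map_iff]
    constructor
    · rintro ⟨y, hy, rfl⟩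
      exact ⟨⟨y, by simpa using Nat.rfind_spec hy⟩, rfl⟩
    · rintro ⟨⟨y, hy⟩, rfl⟩
      have hdom : (Nat.rfind fun y => Part.some (decide (¬ R₂ (n, m, y)))).Dom :=
        Nat.rfind_dom'.2 ⟨y, by simpa using hy, fun _ => trivial⟩
      exact ⟨_, Part.get_mem hdom, rfl⟩
  have hS₁ := exists_numbering_stageDiagram_iff R₁ n hN hG
  rw [← h₁] at hS₁
  have hS₂ : n ∉ S₂ ↔ ∀ m, ∃ y, ¬ R₂ (n, m, y) := by
    rw [h₂]
    push Not
    rfl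
  rw [Set.mem_sdiff, ← hS₁, hS₂]
  constructor
  · rintro ⟨⟨ι, hι, hD⟩, h⟩
    refine ⟨ι, hι, fun m => ?_⟩
    rw [hD, Part.eq_some_iff, Part.eq_some_iff, hmem, hmem]
    exact ⟨fun hm => ⟨h m, (if_pos hm).symm⟩, fun hm => ⟨h m, (if_neg hm).symm⟩⟩
  · rintro ⟨ι, hι, hc⟩
    obtain ⟨ht, hD⟩ := isCharFun_iff.1 hc
    have h : ∀ m, ∃ y, ¬ R₂ (n, m, y) := fun m =>
      (ht m).elim (fun hm => ((hmem m 1).1 hm).1) fun hm => ((hmem m 0).1 hm).1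
    refine ⟨⟨ι, hι, hD.trans (Set.ext fun m => ?_)⟩, h⟩
    rw [Set.mem_ofPred_eq, hmem, and_iff_right (h m)]
    split_ifs with hm <;> simp [hm]

end ScottSentence

theorem mainTheorem5 (G : AddSubgroup ℚ) (hG : ScottSentence.HasComputableCopy G)
    (u : G) (hu : u ≠ 0) (h0 : (ScottSentence.P0 u).Infinite)
    (hfin : (ScottSentence.Pfin u).Finite) (hinf : (ScottSentence.Pinf u).Finite) :
    ScottSentence.HasComputableDSigma2ScottSentence G ∧
      ScottSentence.IsMCompleteDSigma02 (ScottSentence.indexSet G) := by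
  obtain ⟨N, hN, h⟩ := ScottSentence.exists_isIntAdjoinInv u hu hfin hinf
  exact ⟨h.hasScottSentence, h.isMCompleteDSigma02_indexSet hN⟩
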